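/- Metrics may take the value $\infty$. Let $\mathrm{CMet}$ be the category of complete metric spaces and non-expansive (1-Lipschitz) maps. For a metric space $(X,d)$, the path metric $d_\ell(x,y)\in[0,\infty]$ is the infimum of the lengths of the continuous curves from $x$ to $y$, and $(X,d)$ is a path metric space if $d=d_\ell$. A metric space is convex if for all $x\neq y$ with $d(x,y)<\infty$ there is $z\ne x,y$ with $d(x,y)=d(x,z)+d(z,y)$. Let $\mathrm{CPMet}$ and $\mathrm{CCMet}$ be the full subcategories of $\mathrm{CMet}$ consisting of the complete path metric spaces and of the complete convex metric spaces, respectively. For complete metric spaces $X,Y$ let $[X,Y]\in\mathrm{CPMet}$ be the set of non-expansive maps $X\to Y$ with the path metric attached to the supremum metric. For $X\in\mathrm{CCMet}$ this gives the enriched-hom functor $[X,-]\colon\mathrm{CCMet}\to\mathrm{CPMet}$. The object $X\in\mathrm{CCMet}$ is called isometry-$\aleph_0$-generated in the enriched sense if $[X,-]$ preserves all colimits, existing in $\mathrm{CCMet}$, of functors $F\colon I\to\mathrm{CCMet}$, where $I$ is a (small) $\aleph_0$-directed poset (every finite subset has an upper bound) and all the maps $F(i)\to F(j)$, $i\le j$,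 are isometries (distance-preserving maps). The objects of $\mathrm{CCMet}$ that are isometry-$\aleph_0$-generated in the enriched sense are precisely the finite discrete metric spaces, that is, the finite spaces all of whose distances between distinct points are $\infty$. In particular, for every real $\ell>0$ the segment $[0,\ell]$ with its usual metric is not isometry-$\aleph_0$-generated in the enriched sense. -/

import Mathlib

universe u v w

open CategoryTheory CategoryTheory.Limits
open scoped ENNReal Cardinal

/-! ## Intrinsic metrics

All metrics may take the value `∞`. -/

/-- The path (length, intrinsic) distance: the infimum of the lengths of the continuous curves
`f : [a, b] → X` from `x` to `y` (it is `∞` when there are none). The length of `f` is its total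
variation on `[a, b]`. -/
noncomputable def pathEDist {X : Type u} [EMetricSpace X] (x y : X) : ℝ≥0∞ :=
  sInf {L | ∃ (f : ℝ → X) (a b : ℝ), a ≤ b ∧ ContinuousOn f (Set.Icc a b) ∧ f a = x ∧ f b = y ∧
    eVariationOn f (Set.Icc a b) = L}

section PathEDist

variable {X : Type u} [EMetricSpace X]

theorem pathEDist_le_eVariationOn {f : ℝ → X} {a b : ℝ} (hab : a ≤ b)
    (hf : ContinuousOn f (Set.Icc a b)) :
    pathEDist (f a) (f b) ≤ eVariationOn f (Set.Icc a b) :=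
  sInf_le ⟨f, a, b, hab, hf, rfl, rfl, rfl⟩

theorem edist_le_pathEDist (x y : X) : edist x y ≤ pathEDist x y := by
  refine le_sInf ?_
  rintro L ⟨f, a, b, hab, -, rfl, rfl, rfl⟩
  exact eVariationOn.edist_le f (Set.left_mem_Icc.2 hab) (Set.right_mem_Icc.2 hab)

theorem eVariationOn_le_of_lipschitz {g : ℝ → X} (hg : LipschitzWith 1 g) {s t : ℝ} :
    eVariationOn g (Set.Icc s t) ≤ ENNReal.ofReal (t - s) := by
  have h1 := (hg.lipschitzOnWith (s := Set.univ)).comp_eVariationOn_le (g := (id : ℝ → ℝ))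
    (s := Set.Icc s t) (Set.mapsTo_univ _ _)
  rcases le_total s t with hst | hst
  · have h2 := (monotone_id.monotoneOn (Set.Icc s t)).eVariationOn_eq
      (Set.left_mem_Icc.2 hst) (Set.right_mem_Icc.2 hst)
    rw [Set.inter_self] at h2
    rw [h2] at h1
    simpa using h1
  · rw [eVariationOn.subsingleton]
    · exact zero_le
    · intro x hx y hy
      have := hx.1; have := hx.2; have := hy.1; have := hy.2
      linarith

/-- There is a non-expansive curve from `x` to `y` parametrized by `[0, L]`; it is extended
to the whole real line by constants. -/
def LipConn (L : ℝ) (x y : X) : Prop :=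
  ∃ g : ℝ → X, LipschitzWith 1 g ∧ (∀ t ≤ 0, g t = x) ∧ ∀ t, L ≤ t → g t = y

theorem LipConn.pathEDist_le {L : ℝ} (hL : 0 ≤ L) {x y : X} (h : LipConn L x y) :
    pathEDist x y ≤ ENNReal.ofReal L := by
  obtain ⟨g, hg, h0, h1⟩ := h
  have := pathEDist_le_eVariationOn hL hg.continuous.continuousOn
  rw [h0 0 le_rfl, h1 L le_rfl] at this
  simpa using this.trans (eVariationOn_le_of_lipschitz hg)

/-- Arc-length parametrization. -/
theorem lipConn_of_curve {f : ℝ → X} {a b : ℝ} (hab : a ≤ b) (hf : ContinuousOn f (Set.Icc a b))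
    (hv : eVariationOn f (Set.Icc a b) ≠ ∞) :
    LipConn (eVariationOn f (Set.Icc a b)).toReal (f a) (f b) := by
  have hfin : ∀ s t, a ≤ s → t ≤ b → eVariationOn f (Set.Icc s t) ≠ ∞ := fun s t hs ht =>
    ne_top_of_le_ne_top hv (eVariationOn.mono f (Set.Icc_subset_Icc hs ht))
  have hadd : ∀ s t, a ≤ s → s ≤ t → t ≤ b →
      (eVariationOn f (Set.Icc a t)).toReal =
        (eVariationOn f (Set.Icc a s)).toReal + (eVariationOn f (Set.Icc s t)).toReal := by
    intro s t hs hst ht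
    have := eVariationOn.Icc_add_Icc f (s := Set.univ) hs hst (Set.mem_univ _)
    simp only [Set.univ_inter] at this
    rw [← this, ENNReal.toReal_add (hfin _ _ le_rfl (hst.trans ht)) (hfin _ _ hs ht)]
  set V : ℝ → ℝ := fun t => (eVariationOn f (Set.Icc a t)).toReal with hV
  have hVa : V a = 0 := by
    simp only [hV]
    rw [eVariationOn.subsingleton _ (by simp)]; simp
  have hdist : ∀ s ∈ Set.Icc a b, ∀ t ∈ Set.Icc a b,
      edist (f s) (f t) ≤ ENNReal.ofReal |V t - V s| := by
    have key : ∀ s t, a ≤ s → s ≤ t → t ≤ b →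
        edist (f s) (f t) ≤ ENNReal.ofReal |V t - V s| := by
      intro s t hs hst ht
      have h1 : V t - V s = (eVariationOn f (Set.Icc s t)).toReal := by
        simp only [hV]; rw [hadd s t hs hst ht]; ring
      rw [h1, abs_of_nonneg ENNReal.toReal_nonneg, ENNReal.ofReal_toReal (hfin _ _ hs ht)]
      exact eVariationOn.edist_le f (Set.left_mem_Icc.2 hst) (Set.right_mem_Icc.2 hst)
    intro s hs t ht
    rcases le_total s t with h | h
    · exact key s t hs.1 h ht.2
    · rw [edist_comm, abs_sub_comm]; exact key t s ht.1 h hs.2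
  have hcont : ContinuousOn V (Set.Icc a b) := by
    intro x hx
    have hbv : BoundedVariationOn f (Set.Icc a b) := hv
    have hl := hbv.tendsto_eVariationOn_Icc_zero_left (x := x) ((hf x hx).mono Set.inter_subset_left)
    have hr := hbv.tendsto_eVariationOn_Icc_zero_right x ((hf x hx).mono Set.inter_subset_left)
    have hl' := (ENNReal.tendsto_toReal ENNReal.zero_ne_top).comp hl
    have hr' := (ENNReal.tendsto_toReal ENNReal.zero_ne_top).comp hr
    rw [ContinuousWithinAt, tendsto_iff_dist_tendsto_zero]
    have hsum := hl'.add hr'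
    simp only [ENNReal.toReal_zero, add_zero] at hsum
    refine squeeze_zero' (Filter.Eventually.of_forall fun _ => dist_nonneg) ?_ hsum
    filter_upwards [self_mem_nhdsWithin] with y hy
    have e : ∀ s t, a ≤ s → t ≤ b → Set.Icc a b ∩ Set.Icc s t = Set.Icc s t := fun s t hs ht =>
      Set.inter_eq_right.2 (Set.Icc_subset_Icc hs ht)
    simp only [Function.comp, e _ _ hy.1 hx.2, e _ _ hx.1 hy.2, Real.dist_eq]
    rcases le_total y x with h | h
    · have : V x = V y + _ := hadd y x hy.1 h hx.2
      rw [abs_sub_comm, this, add_sub_cancel_left, abs_of_nonneg ENNReal.toReal_nonneg]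
      exact le_add_of_nonneg_right ENNReal.toReal_nonneg
    · have : V y = V x + _ := hadd x y hx.1 h hy.2
      rw [this, add_sub_cancel_left, abs_of_nonneg ENNReal.toReal_nonneg]
      exact le_add_of_nonneg_left ENNReal.toReal_nonneg
  have hsurj : ∀ s ∈ Set.Icc 0 (V b), ∃ t ∈ Set.Icc a b, V t = s := by
    have := intermediate_value_Icc hab hcont
    rw [hVa] at this
    exact fun s hs => this hs
  choose! τ hτ hτV using hsurj
  have hVb : 0 ≤ V b := ENNReal.toReal_nonneg
  have hp : ∀ t, max 0 (min t (V b)) ∈ Set.Icc 0 (V b) := fun t =>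
    ⟨le_max_left _ _, max_le hVb (min_le_right _ _)⟩
  have hz : ∀ s ∈ Set.Icc a b, ∀ t ∈ Set.Icc a b, V s = V t → f s = f t := by
    intro s hs t ht h
    have := hdist s hs t ht
    rw [h] at this
    simpa using this
  refine ⟨fun t => f (τ (max 0 (min t (V b)))), ?_, ?_, ?_⟩
  · intro s t
    refine (hdist _ (hτ _ (hp s)) _ (hτ _ (hp t))).trans ?_
    rw [hτV _ (hp s), hτV _ (hp t), ENNReal.coe_one, one_mul, edist_dist, Real.dist_eq,
      abs_sub_comm s t]
    refine ENNReal.ofReal_le_ofReal ?_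
    refine (abs_max_sub_max_le_max _ _ _ _).trans ?_
    simp only [sub_self, abs_zero]
    refine max_le (abs_nonneg _) ((abs_min_sub_min_le_max _ _ _ _).trans ?_)
    simp
  · intro t ht
    refine hz _ (hτ _ (hp t)) a (Set.left_mem_Icc.2 hab) ?_
    rw [hτV _ (hp t), hVa, min_eq_left (ht.trans hVb), max_eq_left ht]
  · intro t ht
    refine hz _ (hτ _ (hp t)) b (Set.right_mem_Icc.2 hab) ?_
    rw [hτV _ (hp t), min_eq_right ht, max_eq_right hVb]

theorem LipConn.mono {L M : ℝ} (h : L ≤ M) {x y : X} (hL : LipConn L x y) : LipConn M x y := by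
  obtain ⟨g, hg, h0, h1⟩ := hL
  exact ⟨g, hg, h0, fun t ht => h1 t (h.trans ht)⟩

theorem lipConn_of_pathEDist_lt {L : ℝ} {x y : X} (h : pathEDist x y < ENNReal.ofReal L) :
    LipConn L x y := by
  obtain ⟨_, ⟨f, a, b, hab, hf, rfl, rfl, rfl⟩, hlt⟩ := sInf_lt_iff.1 h
  refine (lipConn_of_curve hab hf hlt.ne_top).mono ?_
  have hL : 0 < L := ENNReal.ofReal_pos.1 (bot_le.trans_lt hlt)
  exact (ENNReal.toReal_le_of_le_ofReal hL.le hlt.le)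

theorem LipConn.refl {L : ℝ} (x : X) : LipConn L x x :=
  ⟨fun _ => x, LipschitzWith.const' x, fun _ _ => rfl, fun _ _ => rfl⟩

theorem LipConn.symm {L : ℝ} {x y : X} (h : LipConn L x y) : LipConn L y x := by
  obtain ⟨g, hg, h0, h1⟩ := h
  refine ⟨fun t => g (L - t), fun s t => ?_, fun t ht => h1 _ (by linarith),
    fun t ht => h0 _ (by linarith)⟩
  refine (hg _ _).trans ?_
  simp only [ENNReal.coe_one, one_mul, edist_dist, Real.dist_eq]
  rw [show L - s - (L - t) = -(s - t) by ring, abs_neg]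

/-- Concatenation of two non-expansive curves at a parameter `c` at which they agree. -/
theorem lipschitz_concat {g h : ℝ → X} (hg : LipschitzWith 1 g) (hh : LipschitzWith 1 h) {c : ℝ}
    (hc : g c = h c) : LipschitzWith 1 fun t => if t ≤ c then g t else h t := by
  have key : ∀ s t, s ≤ c → c ≤ t → edist (g s) (h t) ≤ edist s t := by
    intro s t hs ht
    refine (edist_triangle _ (g c) _).trans ?_
    have h1 := hg s c
    have h2 := hh c t
    rw [← hc] at h2
    simp only [ENNReal.coe_one, one_mul] at h1 h2
    refine (add_le_add h1 h2).trans ?_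
    simp only [edist_dist, Real.dist_eq]
    rw [← ENNReal.ofReal_add (abs_nonneg _) (abs_nonneg _), abs_of_nonpos (by linarith),
      abs_of_nonpos (by linarith), abs_of_nonpos (by linarith)]
    exact ENNReal.ofReal_le_ofReal (by linarith)
  intro s t
  rw [ENNReal.coe_one, one_mul]
  by_cases hs : s ≤ c <;> by_cases ht : t ≤ c <;> simp only [hs, ht, if_true, if_false]
  · simpa using hg s t
  · exact key s t hs (le_of_not_ge ht)
  · rw [edist_comm, edist_comm s]; exact key t s ht (le_of_not_ge hs)
  · simpa using hh s t

theorem lipschitz_shift {g : ℝ → X} (hg : LipschitzWith 1 g) (c : ℝ) :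
    LipschitzWith 1 fun t => g (t - c) := fun s t => by
  refine (hg _ _).trans ?_
  simp [edist_dist, Real.dist_eq]

theorem LipConn.trans {L M : ℝ} (hL : 0 ≤ L) {x y z : X} (h : LipConn L x y)
    (h' : LipConn M y z) (hM : 0 < M) : LipConn (L + M) x z := by
  obtain ⟨g, hg, h0, h1⟩ := h
  obtain ⟨k, hk, k0, k1⟩ := h'
  refine ⟨_, lipschitz_concat hg (lipschitz_shift hk L) (c := L) ?_, ?_, ?_⟩
  · simp only [sub_self]; rw [h1 L le_rfl, k0 0 le_rfl]
  · intro t ht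
    simp only [ht.trans hL, if_true]; exact h0 t ht
  · intro t ht
    have : ¬ t ≤ L := by linarith
    simp only [this, if_false]; exact k1 _ (by linarith)

theorem pathEDist_self (x : X) : pathEDist x x = 0 := by
  simpa using (LipConn.refl (L := 0) x).pathEDist_le le_rfl

/-- The upper bounds of the intrinsic distance, by finite positive numbers. -/
theorem pathEDist_le_of_forall {x y : X} {c : ℝ≥0∞}
    (h : ∀ L : ℝ, 0 < L → c < ENNReal.ofReal L → LipConn L x y) : pathEDist x y ≤ c := by
  refine le_of_forall_gt fun d hd => ?_
  obtain ⟨r, hr0, hcr, hrd⟩ := ENNReal.lt_iff_exists_real_btwn.1 hd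
  have hr : 0 < r := ENNReal.ofReal_pos.1 (bot_le.trans_lt hcr)
  exact ((h r hr hcr).pathEDist_le hr.le).trans_lt hrd

theorem pathEDist_comm (x y : X) : pathEDist x y = pathEDist y x := by
  have : ∀ x y : X, pathEDist x y ≤ pathEDist y x := fun x y =>
    pathEDist_le_of_forall fun L _ hL => (lipConn_of_pathEDist_lt hL).symm
  exact le_antisymm (this x y) (this y x)

theorem pathEDist_triangle (x y z : X) : pathEDist x z ≤ pathEDist x y + pathEDist y z := by
  by_cases hxy : pathEDist x y = ∞
  · simp [hxy]
  by_cases hyz : pathEDist y z = ∞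
  · simp [hyz]
  refine ENNReal.le_of_forall_pos_le_add fun ε hε _ => ?_
  have hε2 : (0 : ℝ) < ε / 2 := by positivity
  have key : ∀ a b : X, pathEDist a b ≠ ∞ → LipConn ((pathEDist a b).toReal + ε / 2) a b := by
    intro a b hab
    refine lipConn_of_pathEDist_lt ?_
    rw [ENNReal.lt_ofReal_iff_toReal_lt hab]
    linarith
  have h0 : 0 ≤ (pathEDist x y).toReal := ENNReal.toReal_nonneg
  have h1 : 0 ≤ (pathEDist y z).toReal := ENNReal.toReal_nonneg
  have := ((key x y hxy).trans (by linarith) (key y z hyz) (by linarith)).pathEDist_le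
    (by linarith)
  refine this.trans (le_of_eq ?_)
  rw [show (pathEDist x y).toReal + (ε : ℝ) / 2 + ((pathEDist y z).toReal + (ε : ℝ) / 2)
      = ((pathEDist x y).toReal + (pathEDist y z).toReal) + ε by ring,
    ENNReal.ofReal_add (by linarith) (by positivity), ENNReal.ofReal_add h0 h1,
    ENNReal.ofReal_toReal hxy, ENNReal.ofReal_toReal hyz, ENNReal.ofReal_coe_nnreal]

theorem pathEDist_map_le {Y : Type v} [EMetricSpace Y] {f : X → Y} (hf : LipschitzWith 1 f)
    (x y : X) : pathEDist (f x) (f y) ≤ pathEDist x y :=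
  pathEDist_le_of_forall fun L _ hL => by
    obtain ⟨g, hg, h0, h1⟩ := lipConn_of_pathEDist_lt hL
    refine ⟨f ∘ g, by simpa using hf.comp hg, fun t ht => ?_, fun t ht => ?_⟩
    · simp [h0 t ht]
    · simp [h1 t ht]

theorem pathEDist_le_of_lipschitz {g : ℝ → X} (hg : LipschitzWith 1 g) (s t : ℝ) :
    pathEDist (g s) (g t) ≤ edist s t := by
  have key : ∀ s t, s ≤ t → pathEDist (g s) (g t) ≤ edist s t := by
    intro s t h
    refine ((pathEDist_le_eVariationOn h hg.continuous.continuousOn).trans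
      (eVariationOn_le_of_lipschitz hg)).trans ?_
    rw [edist_comm, edist_dist, Real.dist_eq]
    exact ENNReal.ofReal_le_ofReal (le_abs_self _)
  rcases le_total s t with h | h
  · exact key s t h
  · rw [pathEDist_comm, edist_comm]; exact key t s h

/-- In a complete space, a sequence of points whose successive intrinsic distances are less than
summable bounds converges in the intrinsic metric. -/
theorem exists_lim_of_pathEDist_lt [CompleteSpace X] {x : ℕ → X} {r : ℕ → ℝ}
    (hr : ∀ n, 0 < r n) (hs : Summable r)
    (hx : ∀ n, pathEDist (x n) (x (n + 1)) < ENNReal.ofReal (r n)) :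
    ∃ y, ∀ n, pathEDist (x n) y ≤ ENNReal.ofReal (∑' k, r (k + n)) := by
  choose g hg g0 g1 using fun n => lipConn_of_pathEDist_lt (hx n)
  let a : ℕ → ℝ := fun n => ∑ k ∈ Finset.range n, r k
  have ha : ∀ n, a (n + 1) = a n + r n := fun n => Finset.sum_range_succ _ _
  let F : ℕ → ℝ → X := fun n => Nat.rec (fun _ => x 0)
    (fun n f t => if t ≤ a n then f t else g n (t - a n)) n
  have hF : ∀ n t, F (n + 1) t = if t ≤ a n then F n t else g n (t - a n) := fun _ _ => rfl
  have hFc : ∀ n t, a n ≤ t → F n t = x n := by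
    intro n
    induction n with
    | zero => intro t _; rfl
    | succ n _ =>
      intro t ht
      have := hr n
      rw [ha] at ht
      rw [hF, if_neg (by linarith)]
      exact g1 n _ (by linarith)
  have hFl : ∀ n, LipschitzWith 1 (F n) := by
    intro n
    induction n with
    | zero => exact LipschitzWith.const' (x 0)
    | succ n ih =>
      refine lipschitz_concat ih (lipschitz_shift (hg n) (a n)) (c := a n) ?_
      rw [hFc n _ le_rfl, sub_self, g0 n 0 le_rfl]
  have hstep : ∀ t n, edist (F n t) (F (n + 1) t) ≤ ENNReal.ofReal (r n) := by
    intro t n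
    rw [hF]
    split_ifs with h
    · simp
    · rw [hFc n t (le_of_not_ge h), ← g0 n 0 le_rfl]
      by_cases h' : t - a n ≤ r n
      · refine (hg n _ _).trans ?_
        rw [ENNReal.coe_one, one_mul, edist_dist, Real.dist_eq, abs_of_nonpos (by linarith)]
        exact ENNReal.ofReal_le_ofReal (by linarith)
      · rw [g1 n _ (le_of_not_ge h'), ← g1 n (r n) le_rfl]
        refine (hg n _ _).trans ?_
        rw [ENNReal.coe_one, one_mul, edist_dist, Real.dist_eq, zero_sub, abs_neg,
          abs_of_pos (hr n)]
  have hsum : ∑' n, ENNReal.ofReal (r n) ≠ ∞ := by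
    rw [← ENNReal.ofReal_tsum_of_nonneg (fun n => (hr n).le) hs]
    exact ENNReal.ofReal_ne_top
  have hcau : ∀ t, CauchySeq fun n => F n t := fun t =>
    cauchySeq_of_edist_le_of_tsum_ne_top _ (hstep t) hsum
  choose G hG using fun t => cauchySeq_tendsto_of_complete (hcau t)
  have hGl : LipschitzWith 1 G := fun s t => by
    refine le_of_tendsto ((hG s).edist (hG t)) (Filter.Eventually.of_forall fun n => ?_)
    exact hFl n s t
  have hamono : Monotone a := monotone_nat_of_le_succ fun n => by
    have := hr n
    rw [ha]; linarith
  have hGa : ∀ n, G (a n) = x n := by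
    intro n
    have : ∀ m, n ≤ m → F m (a n) = x n := by
      intro m hm
      induction m, hm using Nat.le_induction with
      | base => exact hFc n _ le_rfl
      | succ m hm ih => rw [hF, if_pos (hamono hm), ih]
    refine tendsto_nhds_unique (hG (a n)) ?_
    refine tendsto_const_nhds.congr' ?_
    filter_upwards [Filter.eventually_ge_atTop n] with m hm
    exact (this m hm).symm
  refine ⟨G (∑' k, r k), fun n => ?_⟩
  rw [← hGa n]
  refine (pathEDist_le_of_lipschitz hGl _ _).trans ?_
  rw [← hs.sum_add_tsum_nat_add n, edist_comm, edist_dist, Real.dist_eq]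
  simp only [a, add_sub_cancel_left]
  rw [abs_of_nonneg (tsum_nonneg fun k => (hr _).le)]

end PathEDist

/-- A metric space is a path (length, intrinsic) metric space when its metric agrees with its
path metric. -/
def IsPathMetric (X : Type u) [EMetricSpace X] : Prop :=
  ∀ x y : X, edist x y = pathEDist x y

/-- The set `X` with the path metric attached to the metric of `X`. -/
def Intrinsic (X : Type u) : Type u := X

namespace Intrinsic

variable (X : Type u) [EMetricSpace X]

noncomputable instance : EMetricSpace (Intrinsic X) where
  edist x y := pathEDist (X := X) x y
  edist_self x := pathEDist_self (X := X) x
  edist_comm x y := pathEDist_comm (X := X) x y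
  edist_triangle x y z := pathEDist_triangle (X := X) x y z
  eq_of_edist_eq_zero {x y} h := by
    have h1 := edist_le_pathEDist (X := X) x y
    have h2 : pathEDist (X := X) x y = 0 := h
    rw [h2] at h1
    exact (edist_eq_zero (γ := X)).1 (le_antisymm h1 bot_le)

theorem edist_eq (x y : Intrinsic X) : edist x y = pathEDist (X := X) x y := rfl

theorem isPathMetric : IsPathMetric (Intrinsic X) := by
  intro x y
  refine le_antisymm (edist_le_pathEDist _ _) (pathEDist_le_of_forall fun L _ hL => ?_)
  obtain ⟨g, hg, h0, h1⟩ := lipConn_of_pathEDist_lt (X := X) hL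
  refine ⟨fun t => (show Intrinsic X from g t), fun s t => ?_, h0, h1⟩
  rw [ENNReal.coe_one, one_mul]
  exact pathEDist_le_of_lipschitz hg s t

instance [CompleteSpace X] : CompleteSpace (Intrinsic X) := by
  refine EMetric.complete_of_convergent_controlled_sequences
    (fun n => ENNReal.ofReal ((1 / 2) ^ n)) (fun n => by positivity) fun x hx => ?_
  obtain ⟨y, hy⟩ := exists_lim_of_pathEDist_lt (X := X) (x := x) (r := fun n => (1 / 2 : ℝ) ^ n)
    (fun n => by positivity) summable_geometric_two (fun n => hx n n (n + 1) le_rfl (by omega))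
  refine ⟨(show Intrinsic X from y), tendsto_iff_edist_tendsto_0.2 ?_⟩
  have h0 := tendsto_sum_nat_add fun n => (1 / 2 : ℝ) ^ n
  have h1 := ENNReal.tendsto_ofReal h0
  rw [ENNReal.ofReal_zero] at h1
  exact tendsto_of_tendsto_of_tendsto_of_le_of_le tendsto_const_nhds h1 (fun _ => bot_le) hy

end Intrinsic

/-! ## Spaces of non-expansive maps -/

/-- Non-expansive (that is, 1-Lipschitz) maps. -/
@[ext]
structure Contraction (X : Type u) (Y : Type v) [EMetricSpace X] [EMetricSpace Y] where
  toFun : X → Y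
  lipschitz : LipschitzWith 1 toFun

namespace Contraction

variable {X : Type u} {Y : Type v} {Z : Type w} [EMetricSpace X] [EMetricSpace Y] [EMetricSpace Z]

instance : FunLike (Contraction X Y) X Y where
  coe := toFun
  coe_injective f g h := by cases f; cases g; cases h; rfl

/-- The identity map. -/
def id (X : Type u) [EMetricSpace X] : Contraction X X := ⟨fun x => x, LipschitzWith.id⟩

/-- The composite `g ∘ f`. -/
def comp (g : Contraction Y Z) (f : Contraction X Y) : Contraction X Z :=
  ⟨fun x => g (f x), by
    have h := g.lipschitz.comp f.lipschitz
    rw [one_mul] at h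
    exact h⟩

/-- The supremum metric. -/
noncomputable instance : EMetricSpace (Contraction X Y) where
  edist f g := ⨆ x, edist (f x) (g x)
  edist_self f := by simp
  edist_comm f g := by simp only [edist_comm]
  edist_triangle f g h := iSup_le fun x => (edist_triangle _ (g x) _).trans
    (add_le_add (le_iSup (fun x => edist (f x) (g x)) x) (le_iSup (fun x => edist (g x) (h x)) x))
  eq_of_edist_eq_zero {f g} h := by
    refine DFunLike.ext f g fun x => edist_eq_zero.1 (le_antisymm ?_ bot_le)
    exact (le_iSup (fun x => edist (f x) (g x)) x).trans_eq h

theorem edist_eq (f g : Contraction X Y) : edist f g = ⨆ x, edist (f x) (g x) := rfl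

theorem edist_apply_le (f g : Contraction X Y) (x : X) : edist (f x) (g x) ≤ edist f g :=
  le_iSup (fun x => edist (f x) (g x)) x

instance [CompleteSpace Y] : CompleteSpace (Contraction X Y) := by
  refine EMetric.complete_of_cauchySeq_tendsto fun f hf => ?_
  have hc : ∀ x, CauchySeq fun n => f n x := fun x => by
    have hu : LipschitzWith 1 fun h : Contraction X Y => h x := fun g h => by
      rw [ENNReal.coe_one, one_mul]
      exact edist_apply_le g h x
    exact hu.uniformContinuous.comp_cauchySeq hf
  choose F hF using fun x => cauchySeq_tendsto_of_complete (hc x)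
  refine ⟨⟨F, fun x y => le_of_tendsto ((hF x).edist (hF y))
    (Filter.Eventually.of_forall fun n => (f n).lipschitz x y)⟩, ?_⟩
  rw [EMetric.tendsto_atTop]
  intro ε hε
  obtain ⟨δ, hδ, hδε⟩ := exists_between hε
  obtain ⟨N, hN⟩ := EMetric.cauchySeq_iff.1 hf δ hδ
  refine ⟨N, fun n hn => lt_of_le_of_lt (iSup_le fun x => ?_) hδε⟩
  refine le_of_tendsto (tendsto_const_nhds.edist (hF x)) ?_
  filter_upwards [Filter.eventually_ge_atTop N] with m hm
  exact (edist_apply_le (f n) (f m) x).trans (hN n hn m hm).le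

/-- Postcomposition with `g` is non-expansive for the supremum metrics. -/
theorem lipschitz_comp (g : Contraction Y Z) :
    LipschitzWith 1 fun f : Contraction X Y => g.comp f := fun f h => by
  rw [ENNReal.coe_one, one_mul]
  refine iSup_le fun x => ?_
  refine le_trans ?_ (edist_apply_le f h x)
  have h := g.lipschitz (f x) (h x)
  rw [ENNReal.coe_one, one_mul] at h
  exact h

end Contraction

/-! ## The categories -/

/-- Complete metric spaces, with possibly infinite distances. -/
structure CMet : Type (u + 1) where
  carrier : Type u
  [emetric : EMetricSpace carrier]
  [complete : CompleteSpace carrier]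

namespace CMet

instance : CoeSort CMet.{u} (Type u) := ⟨carrier⟩

attribute [instance] emetric complete

/-- The morphisms are the non-expansive maps. -/
instance : Category CMet.{u} where
  Hom X Y := Contraction X Y
  id X := Contraction.id X
  comp f g := Contraction.comp g f

end CMet

/-- The class of isometries (distance-preserving maps, not necessarily surjective). -/
def CMet.isometries : MorphismProperty CMet.{u} :=
  fun _ _ f => Isometry (Contraction.toFun f)

/-- The path metric spaces among the complete metric spaces. -/
def CMet.isPath : ObjectProperty CMet.{u} := fun X => IsPathMetric X

/-- Convexity: between any two distinct points at a finite distance there is a third one. -/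
def IsConvexMetric (X : Type u) [EMetricSpace X] : Prop :=
  ∀ x y : X, x ≠ y → edist x y < ∞ → ∃ z, z ≠ x ∧ z ≠ y ∧ edist x y = edist x z + edist z y

/-- The convex spaces among the complete metric spaces. -/
def CMet.isConvex : ObjectProperty CMet.{u} := fun X => IsConvexMetric X

/-- The category of complete path metric spaces. -/
abbrev CPMet : Type (u + 1) := CMet.isPath.{u}.FullSubcategory

/-- The category of complete convex metric spaces. -/
abbrev CCMet : Type (u + 1) := CMet.isConvex.{u}.FullSubcategory

/-- The class of isometries in `CCMet`. -/
def CCMet.isometries : MorphismProperty CCMet.{u} :=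
  CMet.isometries.inverseImage CMet.isConvex.ι

/-! ## Enriched homs -/

/-- The `CPMet`-valued hom `[X, Y]`: the set of non-expansive maps `X → Y`, with the path metric
attached to the supremum metric. -/
noncomputable def CPMet.hom (X Y : CMet.{u}) : CPMet.{u} :=
  ⟨⟨Intrinsic (Contraction X Y)⟩, Intrinsic.isPathMetric (Contraction X Y)⟩

/-- The functor `[X, -] : CMet ⥤ CPMet`. -/
noncomputable def CPMet.homFunctor (X : CMet.{u}) : CMet.{u} ⥤ CPMet.{u} where
  obj Y := CPMet.hom X Y
  map {Y Z} g := ObjectProperty.homMk (show Contraction (Intrinsic (Contraction X Y))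
      (Intrinsic (Contraction X Z)) from
    ⟨fun f => Contraction.comp g f, fun f h => by
      rw [ENNReal.coe_one, one_mul]
      exact pathEDist_map_le (Contraction.lipschitz_comp (X := X) g) f h⟩)
  map_id _ := rfl
  map_comp _ _ := rfl

/-- The enriched-hom functor `[X, -] : CCMet ⥤ CPMet` of the full subcategory `CCMet` of the closed
monoidal category `CPMet`. -/
noncomputable def CCMet.enrichedHom (X : CCMet.{u}) : CCMet.{u} ⥤ CPMet.{u} :=
  CMet.isConvex.ι ⋙ CPMet.homFunctor X.obj

/-! ## Generation -/

/-- A poset is `κ`-directed if every subset of cardinality `< κ` has an upper bound. -/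
def IsKappaDirected (κ : Cardinal.{w}) (I : Type w) [PartialOrder I] : Prop :=
  ∀ S : Set I, #S < κ → ∃ i, ∀ s ∈ S, s ≤ i

/-- The functor `H` preserves the colimits, as far as they exist in `C`, of those diagrams of
morphisms in `M` that are indexed by (small) `κ`-directed posets. -/
def PreservesDirectedColimitsOf {C : Type*} [Category* C] {V : Type*} [Category* V]
    (κ : Cardinal.{w}) (M : MorphismProperty C) (H : C ⥤ V) : Prop :=
  ∀ (I : Type w) [PartialOrder I], IsKappaDirected κ I →
    ∀ F : I ⥤ C, (∀ ⦃i j : I⦄ (f : i ⟶ j), M (F.map f)) → PreservesColimit F H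

/-- An object of `CCMet` is isometry-`κ`-generated in the enriched sense if its enriched-hom functor
preserves `κ`-directed colimits of isometries. -/
def CCMet.IsIsometryGenerated (κ : Cardinal.{u}) (X : CCMet.{u}) : Prop :=
  PreservesDirectedColimitsOf κ CCMet.isometries (CCMet.enrichedHom X)

/-- A metric space is discrete if all its pairwise distances are infinite. -/
def IsDiscreteMetric (X : Type u) [EMetricSpace X] : Prop :=
  ∀ x y : X, x ≠ y → edist x y = ∞

/-- The segment `[0, ℓ]`, with its usual metric, as an object of `CCMet`. -/
noncomputable def CCMet.segment (ℓ : ℝ) : CCMet.{u} :=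
  ⟨⟨ULift.{u} (Set.Icc (0 : ℝ) ℓ)⟩, by
    rintro ⟨x, hx⟩ ⟨y, hy⟩ hxy -
    have hne : x ≠ y := fun h => hxy (by subst h; rfl)
    refine ⟨⟨(x + y) / 2, by linarith [hx.1, hy.1], by linarith [hx.2, hy.2]⟩, ?_, ?_, ?_⟩
    · intro h
      have : (x + y) / 2 = x := congrArg (fun z : ULift.{u} (Set.Icc (0 : ℝ) ℓ) => (z.down : ℝ)) h
      exact hne (by linarith)
    · intro h
      have : (x + y) / 2 = y := congrArg (fun z : ULift.{u} (Set.Icc (0 : ℝ) ℓ) => (z.down : ℝ)) h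
      exact hne (by linarith)
    · change edist x y = edist x ((x + y) / 2) + edist ((x + y) / 2) y
      simp only [edist_dist, Real.dist_eq]
      rw [← ENNReal.ofReal_add (abs_nonneg _) (abs_nonneg _)]
      congr 1
      rw [show x - (x + y) / 2 = (x - y) / 2 by ring, show (x + y) / 2 - y = (x - y) / 2 by ring,
        abs_div]
      norm_num⟩

/-! Colimits of directed diagrams of isometries are recognised metrically: a cocone of isometries
with jointly dense images is a colimit (`nonempty_isColimit`). Conversely, the legs of a colimit
have jointly dense images and are isometries (`dense_coconeRange`, `isometry_of_isColimit`), as one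
sees by testing with truncated distance functions to the real line. The argument works in any full
subcategory of `CMet` containing the line, so in both `CCMet` and `CPMet`.

If `X` is finite and discrete and `Y` is complete and convex, Menger's theorem joins maps `X → Y` at
finite distance by pointwise geodesics, so the supremum metric on `[X, Y]` is already a path metric.
Isometric legs then induce isometric legs, and the finitely many values of a map can be approximated
at one common stage.

Conversely, if `X` is generated and `C` is the closure of a directed union of closed convex
subspaces, every map `X → C` is approximated, in the path metric of `[X, C]`, by maps into a single
subspace (`exists_pathEDist_lt`). For discrete `X`, the finite subsets of `X` and the identity map
show that `X` is finite.

Suppose that `x ≠ y` in `X` are at finite distance `D`. Glue two lines along the nonpositive numbers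
and the points `1 / (n + 1)`. This gives circles shrinking to `0`, and the `n`-th stage omits the
open left halves of all circles from the `n`-th on. Let `f` send `z` to the point `min (d x z) D - D
/ 2` of the left line. In the supremum metric `f` is a limit of maps into stages, since left and
right halves of small circles are close. In the path metric it is not: a curve of length at most `D
/ 4` from `f` to a map into a stage, evaluated along a geodesic from `x` to `y` and retracted to a
small omitted circle, would be a homotopy with fixed ends between the two halves of that circle.
Lifting to the universal cover excludes this. -/

namespace CMet

/-- The non-expansive map underlying a morphism of a full subcategory of `CMet`. -/
def toContraction {P : ObjectProperty CMet.{u}} {X Y : P.FullSubcategory} (f : X ⟶ Y) :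
    Contraction X.obj Y.obj := f.hom

theorem toContraction_comp {P : ObjectProperty CMet.{u}} {X Y Z : P.FullSubcategory} (f : X ⟶ Y)
    (g : Y ⟶ Z) (x : X.obj) : toContraction (f ≫ g) x = toContraction g (toContraction f x) := rfl

/-- A non-expansive map as a morphism of a full subcategory of `CMet`. -/
def ofContraction {P : ObjectProperty CMet.{u}} {X Y : P.FullSubcategory}
    (f : Contraction X.obj Y.obj) : X ⟶ Y := ObjectProperty.homMk (show X.obj ⟶ Y.obj from f)

theorem hom_ext_apply {P : ObjectProperty CMet.{u}} {X Y : P.FullSubcategory} {f g : X ⟶ Y}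
    (h : ∀ x, toContraction f x = toContraction g x) : f = g :=
  ObjectProperty.hom_ext _ (DFunLike.ext (toContraction f) (toContraction g) h)

theorem cocone_w_apply {P : ObjectProperty CMet.{u}} {J : Type*} [Category* J]
    {F : J ⥤ P.FullSubcategory} (c : Cocone F) {i j : J} (f : i ⟶ j) (x : (F.obj i).obj) :
    toContraction (c.ι.app j) (toContraction (F.map f) x) = toContraction (c.ι.app i) x := by
  rw [← toContraction_comp, c.w]

end CMet

/-! ### Extension from dense subsets and truncated distance functions -/

namespace Contraction

theorem edist_map_le {X : Type u} {Y : Type v} [EMetricSpace X] [EMetricSpace Y]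
    (f : Contraction X Y) (x y : X) : edist (f x) (f y) ≤ edist x y := by
  have h := f.lipschitz x y
  rwa [ENNReal.coe_one, one_mul] at h

/-- The non-expansive extension of a non-expansive map from a dense subset. -/
theorem exists_extension {X : Type u} {Y : Type v} [EMetricSpace X] [EMetricSpace Y]
    [CompleteSpace Y] {D : Set X} (hD : Dense D) (g : D → Y)
    (hg : ∀ x y : D, edist (g x) (g y) ≤ edist (x : X) y) :
    ∃ f : Contraction X Y, ∀ x : D, f x = g x := by
  have hgl : LipschitzWith 1 g := fun x y => by
    rw [ENNReal.coe_one, one_mul]; exact hg x y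
  have hu : IsUniformInducing ((↑) : D → X) := isometry_subtype_coe.isUniformInducing
  have hd : DenseRange ((↑) : D → X) := hD.denseRange_val
  have hc := uniformContinuous_uniformly_extend hu hd hgl.uniformContinuous
  have he : ∀ x : D, (hu.isDenseInducing hd).extend g x = g x := fun x =>
    uniformly_extend_of_ind hu hd hgl.uniformContinuous x
  refine ⟨⟨(hu.isDenseInducing hd).extend g, fun x y => ?_⟩, he⟩
  rw [ENNReal.coe_one, one_mul]
  refine hd.induction_on₂ (p := fun x y => edist ((hu.isDenseInducing hd).extend g x)
    ((hu.isDenseInducing hd).extend g y) ≤ edist x y) ?_ ?_ x y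
  · exact isClosed_le ((hc.continuous.comp continuous_fst).edist (hc.continuous.comp continuous_snd))
      (continuous_fst.edist continuous_snd)
  · intro a b
    rw [he, he]
    exact hg a b

/-- The real-valued non-expansive map obtained by truncating at `N`. -/
noncomputable def truncate {X : Type v} [EMetricSpace X] (h : X → ℝ≥0∞) (N : ℝ≥0∞) (hN : N ≠ ∞)
    (hh : ∀ x y, h x ≤ h y + edist x y) : Contraction X (ULift.{u} ℝ) where
  toFun x := ⟨(min (h x) N).toReal⟩
  lipschitz x y := by
    rw [ENNReal.coe_one, one_mul]
    change edist (min (h x) N).toReal (min (h y) N).toReal ≤ edist x y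
    have hx : ∀ x, min (h x) N ≠ ∞ := fun x => ne_top_of_le_ne_top hN (min_le_right _ _)
    by_cases hxy : edist x y = ∞
    · rw [hxy]; exact le_top
    have key : ∀ x y, edist x y ≠ ∞ →
        (min (h x) N).toReal - (min (h y) N).toReal ≤ (edist x y).toReal := by
      intro x y hxy
      rw [sub_le_iff_le_add', ← ENNReal.toReal_add (hx y) hxy]
      refine ENNReal.toReal_mono (ENNReal.add_ne_top.2 ⟨hx y, hxy⟩) ?_
      rw [← min_add_add_right]
      exact min_le_min (hh x y) le_self_add
    rw [edist_dist, Real.dist_eq]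
    refine ENNReal.ofReal_le_of_le_toReal (abs_le.2 ⟨?_, key x y hxy⟩)
    have := key y x (by rwa [edist_comm])
    rw [edist_comm y x] at this
    linarith

end Contraction

/-! ### The real line as a test object -/

theorem LipConn.real (x y : ℝ) : LipConn.{u} |x - y| (ULift.up x) (ULift.up y) := by
  have main : ∀ x y : ℝ, x ≤ y → LipConn.{u} (y - x) (ULift.up x) (ULift.up y) := by
    intro x y h
    refine ⟨fun t => ⟨max x (min y (x + t))⟩, fun s t => ?_, fun t ht => ?_, fun t ht => ?_⟩
    · rw [ENNReal.coe_one, one_mul]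
      change edist (max x (min y (x + s))) (max x (min y (x + t))) ≤ _
      rw [edist_dist, edist_dist, Real.dist_eq, Real.dist_eq]
      refine ENNReal.ofReal_le_ofReal ?_
      refine (abs_max_sub_max_le_max _ _ _ _).trans ?_
      simp only [sub_self, abs_zero]
      refine max_le (abs_nonneg _) ((abs_min_sub_min_le_max _ _ _ _).trans ?_)
      simp
    · simp [ht]
    · have : y ≤ x + t := by linarith
      simp [this, h]
  rcases le_total x y with h | h
  · rw [abs_sub_comm, abs_of_nonneg (by linarith)]
    exact main x y h
  · rw [abs_of_nonneg (by linarith)]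
    exact (main y x h).symm

/-- The real line is a path metric space. -/
theorem isPathMetric_real : IsPathMetric (ULift.{u} ℝ) := by
  intro x y
  refine le_antisymm (edist_le_pathEDist _ _) ?_
  refine ((LipConn.real x.down y.down).pathEDist_le (abs_nonneg _)).trans_eq ?_
  rw [← Real.dist_eq, ← edist_dist]; rfl

/-- The real line is convex. -/
theorem isConvexMetric_real : IsConvexMetric (ULift.{u} ℝ) := by
  rintro ⟨x⟩ ⟨y⟩ hxy -
  have hne : x ≠ y := fun h => hxy (by rw [h])
  refine ⟨⟨(x + y) / 2⟩, ?_, ?_, ?_⟩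
  · intro h
    have := congrArg ULift.down h
    exact hne (by dsimp at this; linarith)
  · intro h
    have := congrArg ULift.down h
    exact hne (by dsimp at this; linarith)
  · change edist x y = edist x ((x + y) / 2) + edist ((x + y) / 2) y
    simp only [edist_dist, Real.dist_eq]
    rw [← ENNReal.ofReal_add (abs_nonneg _) (abs_nonneg _)]
    congr 1
    rw [show x - (x + y) / 2 = (x - y) / 2 by ring, show (x + y) / 2 - y = (x - y) / 2 by ring,
      abs_div]
    norm_num

/-! ### Colimits of directed diagrams of isometries -/

namespace CMet

open Contraction

section Colimits

variable {P : ObjectProperty CMet.{u}}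

/-- The points of a cocone that come from the diagram. -/
def coconeRange {J : Type*} [Category* J] {F : J ⥤ P.FullSubcategory} (c : Cocone F) :
    Set c.pt.obj := {y | ∃ i x, toContraction (c.ι.app i) x = y}

/-- A cocone of isometries with jointly dense images on a directed diagram is a colimit. -/
theorem nonempty_isColimit {I : Type u} [PartialOrder I]
    [IsDirectedOrder I] {F : I ⥤ P.FullSubcategory} (c : Cocone F)
    (hc : ∀ i, Isometry (toContraction (c.ι.app i))) (hd : Dense (coconeRange c)) :
    Nonempty (IsColimit c) := by
  -- Both points are moved to a common stage, where the leg of `c` preserves their distance and the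
  -- leg of `s` can only shrink it.
  have hg : ∀ (s : Cocone F) i x j y, edist (toContraction (s.ι.app i) x)
      (toContraction (s.ι.app j) y) ≤
        edist (toContraction (c.ι.app i) x) (toContraction (c.ι.app j) y) := by
    intro s i x j y
    obtain ⟨k, hik, hjk⟩ := exists_ge_ge i j
    rw [← cocone_w_apply s (homOfLE hik), ← cocone_w_apply s (homOfLE hjk),
      ← cocone_w_apply c (homOfLE hik), ← cocone_w_apply c (homOfLE hjk), (hc k).edist_eq]
    exact edist_map_le _ _ _
  have hex : ∀ s : Cocone F, ∃ f : Contraction c.pt.obj s.pt.obj,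
      ∀ i x, f (toContraction (c.ι.app i) x) = toContraction (s.ι.app i) x := by
    intro s
    choose i x hx using fun y : coconeRange c => y.2
    obtain ⟨f, hf⟩ := exists_extension (Y := s.pt.obj) hd
      (fun y : coconeRange c => toContraction (s.ι.app (i y)) (x y))
      (fun y z => (hg s _ (x y) _ (x z)).trans_eq (by rw [hx y, hx z]))
    refine ⟨f, fun j z => ?_⟩
    -- The representative chosen for this point need not be `(j, z)`; `hg` at distance `0` shows
    -- that the choice is immaterial.
    let y : coconeRange c := ⟨toContraction (c.ι.app j) z, j, z, rfl⟩
    refine (hf y).trans (edist_eq_zero.1 (le_antisymm ?_ bot_le))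
    refine (hg s _ _ _ _).trans_eq ?_
    rw [hx y, edist_self]
  choose f hf using hex
  refine ⟨{ desc := fun s => ofContraction (f s), fac := ?_, uniq := ?_ }⟩
  · intro s i
    exact hom_ext_apply (hf s i)
  · intro s m hm
    refine hom_ext_apply fun x => ?_
    refine congrFun (Continuous.ext_on hd (toContraction m).lipschitz.continuous
      (f s).lipschitz.continuous ?_) x
    rintro _ ⟨i, x, rfl⟩
    have h1 : toContraction m (toContraction (c.ι.app i) x) = toContraction (s.ι.app i) x := by
      rw [← toContraction_comp, hm]
    exact h1.trans (hf s i x).symm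

/-- The images of the legs of a colimit cocone are jointly dense. -/
theorem dense_coconeRange (hP : P ⟨ULift.{u} ℝ⟩) {J : Type*} [Category* J]
    {F : J ⥤ P.FullSubcategory} {c : Cocone F} (hc : IsColimit c) : Dense (coconeRange c) := by
  intro z
  rw [Metric.mem_closure_iff_infEDist_zero]
  let R : P.FullSubcategory := ⟨⟨ULift.{u} ℝ⟩, hP⟩
  have hh : ∀ x y, Metric.infEDist x (coconeRange c) ≤
      Metric.infEDist y (coconeRange c) + edist x y := fun x y =>
    Metric.infEDist_le_infEDist_add_edist
  -- The truncated distance to the union of the images and the constant `0` agree on every leg,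
  -- hence everywhere.
  let f : c.pt ⟶ R := ofContraction (truncate _ 1 ENNReal.one_ne_top hh)
  let g : c.pt ⟶ R := ofContraction
    (truncate (fun _ => 0) 1 ENNReal.one_ne_top fun _ _ => bot_le)
  have hfg : f = g := by
    refine hc.hom_ext fun i => hom_ext_apply fun x => ?_
    refine ULift.down_injective ?_
    change (min (Metric.infEDist (toContraction (c.ι.app i) x) (coconeRange c)) 1).toReal =
      (min 0 1 : ℝ≥0∞).toReal
    have hm : toContraction (c.ι.app i) x ∈ coconeRange c := ⟨i, x, rfl⟩
    rw [Metric.infEDist_zero_of_mem hm]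
  have h : (min (Metric.infEDist z (coconeRange c)) 1).toReal = (min 0 1 : ℝ≥0∞).toReal :=
    congrArg (fun k : c.pt ⟶ R => ULift.down (toContraction k z : ULift.{u} ℝ)) hfg
  rw [min_eq_left zero_le_one, ENNReal.toReal_zero, ENNReal.toReal_eq_zero_iff] at h
  rcases h with h | h
  · rcases min_eq_iff.1 h with h | h
    · exact h.1
    · exact absurd h.1 one_ne_zero
  · exact absurd h (ne_top_of_le_ne_top ENNReal.one_ne_top (min_le_right _ _))

/-- The legs of the colimit of a directed diagram of isometries are isometries. -/
theorem isometry_of_isColimit (hP : P ⟨ULift.{u} ℝ⟩) {I : Type u} [PartialOrder I]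
    [IsDirectedOrder I] {F : I ⥤ P.FullSubcategory}
    (hF : ∀ ⦃i j : I⦄ (f : i ⟶ j), Isometry (toContraction (F.map f)))
    {c : Cocone F} (hc : IsColimit c) (i : I) : Isometry (toContraction (c.ι.app i)) := by
  intro x y
  refine le_antisymm (edist_map_le _ _ _) ?_
  let R : P.FullSubcategory := ⟨⟨ULift.{u} ℝ⟩, hP⟩
  -- `d j z` is the distance from `x` to `z`, measured above both `i` and `j`. It does not depend on
  -- the upper bound since the transition maps are isometries, so the functions `d j` are compatible
  -- with the diagram.
  choose k hik hjk using fun j : I => exists_ge_ge i j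
  let d : ∀ j, (F.obj j).obj → ℝ≥0∞ := fun j z =>
    edist (toContraction (F.map (homOfLE (hik j))) x) (toContraction (F.map (homOfLE (hjk j))) z)
  have hd : ∀ {j l} (hil : i ≤ l) (hjl : j ≤ l) z, d j z =
      edist (toContraction (F.map (homOfLE hil)) x) (toContraction (F.map (homOfLE hjl)) z) := by
    intro j l hil hjl z
    obtain ⟨m, hkm, hlm⟩ := exists_ge_ge (k j) l
    have e1 := (hF (homOfLE hkm)).edist_eq (toContraction (F.map (homOfLE (hik j))) x)
      (toContraction (F.map (homOfLE (hjk j))) z)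
    have e2 := (hF (homOfLE hlm)).edist_eq (toContraction (F.map (homOfLE hil)) x)
      (toContraction (F.map (homOfLE hjl)) z)
    simp only [← toContraction_comp, ← F.map_comp, homOfLE_comp] at e1 e2
    exact e1.symm.trans e2
  have hdl : ∀ j (z w : (F.obj j).obj), d j z ≤ d j w + edist z w := by
    intro j z w
    refine (edist_triangle_right _ _ (toContraction (F.map (homOfLE (hjk j))) w)).trans ?_
    exact add_le_add le_rfl (edist_map_le _ _ _)
  -- Truncation at a finite `N` below the distance makes the `d j` a cocone over the line; its
  -- values at `x` and `y` are `0` and `N`, and the descended map is non-expansive.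
  refine ENNReal.le_of_forall_nnreal_lt fun N hN => ?_
  let s : Cocone F :=
    { pt := R
      ι :=
        { app := fun j => ofContraction (truncate (d j) N ENNReal.coe_ne_top (hdl j))
          naturality := by
            intro j l f
            refine hom_ext_apply fun z => ULift.down_injective ?_
            change (min (d l (toContraction (F.map f) z)) N).toReal = (min (d j z) N).toReal
            rw [hd ((hik l)) ((leOfHom f).trans (hjk l)) z]
            congr 2
            simp only [d, ← toContraction_comp, ← F.map_comp]
            rfl } }
  have hs : ∀ z, toContraction (hc.desc s) (toContraction (c.ι.app i) z) =
      toContraction (s.ι.app i) z := by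
    intro z
    rw [← toContraction_comp, hc.fac]
  refine le_trans ?_ (edist_map_le (toContraction (hc.desc s)) _ _)
  rw [hs, hs]
  change _ ≤ edist (min (d i x) N).toReal (min (d i y) N).toReal
  rw [hd (le_refl i) (le_refl i), hd (le_refl i) (le_refl i), (hF _).edist_eq, (hF _).edist_eq,
    edist_self, min_eq_right hN.le, edist_dist, Real.dist_eq]
  simp

end Colimits

end CMet

/-! ### Geodesics in complete convex spaces -/

/-- Insertion of an intermediate point into a partial geodesic. -/
theorem edist_eq_of_between {X : Type u} [EMetricSpace X] {p q z u : X} {l a b : ℝ} (hl : 0 ≤ l)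
    (ha : 0 ≤ a) (hb : 0 ≤ b) (hpz : edist z p = ENNReal.ofReal a)
    (hzq : edist z q = ENNReal.ofReal b) (hup : edist u p = ENNReal.ofReal l)
    (huq : edist u q = ENNReal.ofReal (l + a + b)) : edist z u = ENNReal.ofReal (l + a) := by
  rw [edist_comm]
  refine le_antisymm ?_ ?_
  · refine (edist_triangle u p z).trans ?_
    rw [edist_comm p, hpz, hup, ENNReal.ofReal_add hl ha]
  · have h := edist_triangle u z q
    rw [huq, hzq, ENNReal.ofReal_add (by linarith) hb] at h
    exact (ENNReal.add_le_add_iff_right ENNReal.ofReal_ne_top).1 h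

/-- Menger's theorem: in a complete convex metric space, two points at a finite distance are joined
by a geodesic. -/
theorem IsConvexMetric.lipConn {X : Type u} [EMetricSpace X] [CompleteSpace X]
    (hX : IsConvexMetric X) {x y : X} (hxy : edist x y ≠ ∞) :
    LipConn (edist x y).toReal x y := by
  set D := (edist x y).toReal with hD
  have hD0 : 0 ≤ D := ENNReal.toReal_nonneg
  have hDe : edist x y = ENNReal.ofReal D := (ENNReal.ofReal_toReal hxy).symm
  -- Graphs of partial geodesics, that is, of isometric maps from subsets of `[0, D]`; Zorn's lemma
  -- gives a maximal one through both endpoints.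
  let S : Set (Set (ℝ × X)) := {G | (∀ p ∈ G, p.1 ∈ Set.Icc 0 D) ∧
    ∀ p ∈ G, ∀ q ∈ G, edist p.2 q.2 = edist p.1 q.1}
  have h0 : ({(0, x), (D, y)} : Set (ℝ × X)) ∈ S := by
    have e : edist (0 : ℝ) D = edist x y := by
      rw [hDe, edist_dist, Real.dist_eq, zero_sub, abs_neg, abs_of_nonneg hD0]
    refine ⟨?_, ?_⟩
    · rintro p (rfl | rfl)
      · exact ⟨le_rfl, hD0⟩
      · exact ⟨hD0, le_rfl⟩
    · rintro p (rfl | rfl) q (rfl | rfl)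
      · simp
      · exact e.symm
      · rw [edist_comm, edist_comm (D : ℝ)]; exact e.symm
      · simp
  obtain ⟨G, hG0, hG⟩ := zorn_subset_nonempty S (fun c hc hch _ => by
    refine ⟨⋃₀ c, ⟨?_, ?_⟩, fun s hs => Set.subset_sUnion_of_mem hs⟩
    · rintro p ⟨s, hs, hp⟩
      exact (hc hs).1 p hp
    · rintro p ⟨s, hs, hp⟩ q ⟨t, ht, hq⟩
      rcases hch.total hs ht with h | h
      · exact (hc ht).2 p (h hp) q hq
      · exact (hc hs).2 p hp q (h hq)) _ h0
  obtain ⟨hGD, hGi⟩ := hG.prop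
  -- The defining conditions are closed, so by maximality `G` contains its closure.
  have hGc : IsClosed G := by
    refine closure_subset_iff_isClosed.1 (hG.le_of_ge ⟨?_, ?_⟩ subset_closure)
    · intro p hp
      have : closure G ⊆ Prod.fst ⁻¹' Set.Icc (0 : ℝ) D :=
        closure_minimal hGD (isClosed_Icc.preimage continuous_fst)
      exact this hp
    · intro p hp q hq
      have h2 : (p, q) ∈ closure (G ×ˢ G) := by
        rw [closure_prod_eq]; exact ⟨hp, hq⟩
      have : closure (G ×ˢ G) ⊆ {r : (ℝ × X) × ℝ × X | edist r.1.2 r.2.2 = edist r.1.1 r.2.1} := by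
        refine closure_minimal ?_ (isClosed_eq (by fun_prop) (by fun_prop))
        rintro ⟨p, q⟩ ⟨hp, hq⟩
        exact hGi p hp q hq
      exact this h2
  -- On `G` the projection to the parameter is an isometry, and `G` is complete.
  have hT : IsClosed (Prod.fst '' G) := by
    have hiso : Isometry fun p : G => p.1.1 := by
      intro p q
      change edist p.1.1 q.1.1 = max (edist p.1.1 q.1.1) (edist p.1.2 q.1.2)
      rw [hGi _ p.2 _ q.2, max_self]
    have : CompleteSpace G := hGc.completeSpace_coe
    have := hiso.isClosedEmbedding.isClosed_range
    rwa [Set.image_eq_range]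
  have hT0 : (0 : ℝ) ∈ Prod.fst '' G := ⟨_, hG0 (Set.mem_insert _ _), rfl⟩
  have hTD : D ∈ Prod.fst '' G := ⟨_, hG0 (Set.mem_insert_of_mem _ rfl), rfl⟩
  have hsurj : ∀ t ∈ Set.Icc 0 D, ∃ p, (t, p) ∈ G := by
    intro t ht
    by_contra hcon
    have htT : t ∉ Prod.fst '' G := by
      rintro ⟨⟨_, p⟩, hp, rfl⟩
      exact hcon ⟨p, hp⟩
    -- A missing parameter `t` lies in a gap `(α, β)` whose ends belong to the closed parameter set.
    -- Convexity gives a point `z` between the corresponding `p` and `q`, to be inserted at the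
    -- parameter `α + d(p, z)`.
    have hbα : BddAbove (Prod.fst '' G ∩ Set.Iic t) := ⟨t, fun _ h => h.2⟩
    have hbβ : BddBelow (Prod.fst '' G ∩ Set.Ici t) := ⟨t, fun _ h => h.2⟩
    have hα := (hT.inter isClosed_Iic).csSup_mem ⟨0, hT0, ht.1⟩ hbα
    have hβ := (hT.inter isClosed_Ici).csInf_mem ⟨D, hTD, ht.2⟩ hbβ
    have hgap : ∀ s ∈ Prod.fst '' G, s ≤ sSup (Prod.fst '' G ∩ Set.Iic t) ∨
        sInf (Prod.fst '' G ∩ Set.Ici t) ≤ s := by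
      intro s hs
      rcases le_total s t with h | h
      · exact Or.inl (le_csSup hbα ⟨hs, h⟩)
      · exact Or.inr (csInf_le hbβ ⟨hs, h⟩)
    generalize sSup (Prod.fst '' G ∩ Set.Iic t) = α at hα hgap
    generalize sInf (Prod.fst '' G ∩ Set.Ici t) = β at hβ hgap
    obtain ⟨⟨⟨α, p⟩, hp, rfl⟩, hαt⟩ := hα
    obtain ⟨⟨⟨β, q⟩, hq, rfl⟩, hβt⟩ := hβ
    have hαt : α < t := lt_of_le_of_ne hαt fun h => htT ⟨_, hp, h⟩
    have hβt : t < β := lt_of_le_of_ne hβt fun h => htT ⟨_, hq, h.symm⟩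
    have hpq := hGi _ hp _ hq
    dsimp only at hpq hgap
    rw [edist_dist α, Real.dist_eq, abs_of_nonpos (by linarith)] at hpq
    have hne : p ≠ q := by
      rintro rfl
      rw [edist_self, eq_comm, ENNReal.ofReal_eq_zero] at hpq
      linarith
    obtain ⟨z, hzp, hzq, hz⟩ := hX p q hne (by rw [hpq]; exact ENNReal.ofReal_lt_top)
    rw [hpq] at hz
    have hf1 : edist p z ≠ ∞ := fun h => by simp [h] at hz
    have hf2 : edist z q ≠ ∞ := fun h => by simp [h] at hz
    obtain ⟨a, ha⟩ : ∃ a, a = (edist p z).toReal := ⟨_, rfl⟩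
    obtain ⟨b, hb⟩ : ∃ b, b = (edist z q).toReal := ⟨_, rfl⟩
    have ha0 : 0 < a := by
      rw [ha]; exact ENNReal.toReal_pos (edist_pos.2 hzp.symm).ne' hf1
    have hb0 : 0 < b := by
      rw [hb]; exact ENNReal.toReal_pos (edist_pos.2 hzq).ne' hf2
    have ea : edist z p = ENNReal.ofReal a := by
      rw [ha, ENNReal.ofReal_toReal hf1, edist_comm]
    have eb : edist z q = ENNReal.ofReal b := by rw [hb, ENNReal.ofReal_toReal hf2]
    have hab : β = α + a + b := by
      rw [edist_comm p, ea, eb, ← ENNReal.ofReal_add ha0.le hb0.le,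
        ENNReal.ofReal_eq_ofReal_iff (by linarith) (by linarith)] at hz
      linarith
    -- Every other parameter lies on one side of the gap; the triangle inequality through the near
    -- end and towards the far end forces the required distance.
    have hz' : ∀ r ∈ G, edist z r.2 = edist (α + a) r.1 := by
      rintro ⟨s, r⟩ hr
      have h1 := hGi _ hr _ hp
      have h2 := hGi _ hr _ hq
      simp only [edist_dist s, Real.dist_eq] at h1 h2
      simp only [edist_dist (α + a), Real.dist_eq]
      rcases hgap s ⟨_, hr, rfl⟩ with h | h
      · rw [abs_of_nonpos (by linarith)] at h1 h2
        rw [abs_of_nonneg (by linarith)]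
        rw [edist_eq_of_between (l := α - s) (a := a) (b := b) (by linarith) ha0.le hb0.le ea eb]
        · congr 1; ring
        · rw [h1]; congr 1; ring
        · rw [h2]; congr 1; linarith
      · rw [abs_of_nonneg (by linarith)] at h1 h2
        rw [abs_of_nonpos (by linarith)]
        rw [edist_eq_of_between (l := s - β) (a := b) (b := a) (by linarith) hb0.le ha0.le eb ea]
        · congr 1; linarith
        · rw [h2]
        · rw [h1]; congr 1; linarith
    have hins : insert (α + a, z) G ∈ S := by
      have hα0 := (hGD _ hp).1
      have hβ0 := (hGD _ hq).2
      dsimp only at hα0 hβ0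
      refine ⟨?_, ?_⟩
      · rintro r (rfl | hr)
        · exact ⟨by dsimp only; linarith, by dsimp only; linarith⟩
        · exact hGD r hr
      · rintro r (rfl | hr) r' (rfl | hr')
        · simp
        · exact hz' r' hr'
        · rw [edist_comm, edist_comm r.1]; exact hz' r hr
        · exact hGi r hr r' hr'
    have hmem : (α + a, z) ∈ G := hG.le_of_ge hins (Set.subset_insert _ _) (Set.mem_insert _ _)
    rcases hgap (α + a) ⟨_, hmem, rfl⟩ with h | h <;> linarith
  have : Nonempty X := ⟨x⟩
  choose! γ hγ using hsurj
  have hc : ∀ t, max 0 (min t D) ∈ Set.Icc 0 D := fun t =>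
    ⟨le_max_left _ _, max_le hD0 (min_le_right _ _)⟩
  -- The graph is single-valued: equal parameters have distance `0`.
  have heq : ∀ {t p q}, (t, p) ∈ G → (t, q) ∈ G → p = q := by
    intro t p q hp hq
    have := hGi _ hp _ hq
    rwa [edist_self, edist_eq_zero] at this
  refine ⟨fun t => γ (max 0 (min t D)), fun s t => ?_, fun t ht => ?_, fun t ht => ?_⟩
  · rw [hGi _ (hγ _ (hc s)) _ (hγ _ (hc t)), ENNReal.coe_one, one_mul, edist_dist, edist_dist,
      Real.dist_eq, Real.dist_eq]
    refine ENNReal.ofReal_le_ofReal ((abs_max_sub_max_le_max _ _ _ _).trans ?_)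
    simp only [sub_self, abs_zero]
    refine max_le (abs_nonneg _) ((abs_min_sub_min_le_max _ _ _ _).trans ?_)
    simp
  · have h := hγ _ (hc t)
    rw [min_eq_left (ht.trans hD0), max_eq_left ht] at h
    simp only [min_eq_left (ht.trans hD0), max_eq_left ht]
    exact heq h (hG0 (Set.mem_insert _ _))
  · have h := hγ _ (hc t)
    rw [min_eq_right ht, max_eq_right hD0] at h
    simp only [min_eq_right ht, max_eq_right hD0]
    exact heq h (hG0 (Set.mem_insert_of_mem _ rfl))

theorem IsKappaDirected.nonempty {I : Type u} [PartialOrder I] (hI : IsKappaDirected ℵ₀ I) :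
    Nonempty I := by
  obtain ⟨i, -⟩ := hI ∅ (by simpa using Cardinal.aleph0_pos)
  exact ⟨i⟩

theorem IsKappaDirected.isDirectedOrder {I : Type u} [PartialOrder I]
    (hI : IsKappaDirected ℵ₀ I) : IsDirectedOrder I :=
  ⟨fun i j => by
    obtain ⟨k, hk⟩ := hI {i, j} (Set.toFinite _).lt_aleph0
    exact ⟨k, hk i (by simp), hk j (by simp)⟩⟩

theorem isKappaDirected_aleph0 (I : Type u) [PartialOrder I] [Nonempty I] [IsDirectedOrder I] :
    IsKappaDirected ℵ₀ I := fun S hS => by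
  have hf : S.Finite := Cardinal.lt_aleph0_iff_set_finite.1 hS
  exact hf.bddAbove

/-! ### Maps out of discrete spaces -/

namespace IsDiscreteMetric

variable {X : Type u} {Y : Type v} [EMetricSpace X] [EMetricSpace Y]

theorem lipschitz (hX : IsDiscreteMetric X) (f : X → Y) : LipschitzWith 1 f := fun x y => by
  by_cases h : x = y
  · simp [h]
  · rw [hX x y h]; simp

theorem isConvexMetric (hX : IsDiscreteMetric X) : IsConvexMetric X := fun x y hxy h =>
  absurd (hX x y hxy) h.ne

/-- On a discrete space, the supremum metric on the maps to a complete convex space is intrinsic. -/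
theorem pathEDist_contraction (hX : IsDiscreteMetric X) [CompleteSpace Y] (hY : IsConvexMetric Y)
    (f g : Contraction X Y) : pathEDist f g = edist f g := by
  refine le_antisymm ?_ (edist_le_pathEDist _ _)
  by_cases hfg : edist f g = ∞
  · rw [hfg]; exact le_top
  have hx : ∀ x, edist (f x) (g x) ≠ ∞ := fun x =>
    ne_top_of_le_ne_top hfg (Contraction.edist_apply_le f g x)
  -- All geodesics are run over one interval, of length the supremum distance, the shorter ones
  -- waiting at their ends. Together they form a curve of maps, as every map out of a discrete space
  -- is non-expansive.
  have hL : ∀ x, LipConn (edist f g).toReal (f x) (g x) := fun x =>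
    (hY.lipConn (hx x)).mono (ENNReal.toReal_mono hfg (Contraction.edist_apply_le f g x))
  choose γ hγ h0 h1 using hL
  have h : LipConn (edist f g).toReal f g := by
    refine ⟨fun t => ⟨fun x => γ x t, hX.lipschitz _⟩, fun s t => ?_, fun t ht => ?_,
      fun t ht => ?_⟩
    · exact iSup_le fun x => hγ x s t
    · exact DFunLike.ext _ _ fun x => h0 x t ht
    · exact DFunLike.ext _ _ fun x => h1 x t ht
  exact (h.pathEDist_le ENNReal.toReal_nonneg).trans_eq (ENNReal.ofReal_toReal hfg)

end IsDiscreteMetric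

/-! ### Generation: finite discrete spaces and approximation by subspaces -/

namespace CCMet

open CMet

theorem isIsometryGenerated_of_finite (X : CCMet.{u}) [Finite X.obj] (hX : IsDiscreteMetric X.obj) :
    X.IsIsometryGenerated ℵ₀ := by
  intro I _ hI F hF
  have := hI.nonempty
  have := hI.isDirectedOrder
  refine ⟨fun {c} hc => ?_⟩
  have hiso := isometry_of_isColimit (P := CMet.isConvex.{u}) isConvexMetric_real hF hc
  have hd := dense_coconeRange (P := CMet.isConvex.{u}) isConvexMetric_real hc
  refine nonempty_isColimit ((enrichedHom X).mapCocone c) (fun i => ?_) ?_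
  · intro f g
    change Contraction X.obj (F.obj i).obj at f g
    change pathEDist ((toContraction (c.ι.app i)).comp f) ((toContraction (c.ι.app i)).comp g) =
      pathEDist f g
    rw [hX.pathEDist_contraction c.pt.property, hX.pathEDist_contraction (F.obj i).property]
    exact iSup_congr fun x => hiso i (f x) (g x)
  · intro f
    change Contraction X.obj c.pt.obj at f
    refine EMetric.mem_closure_iff.2 fun ε hε => ?_
    -- The intermediate `δ` keeps the bound strict after the supremum over `x`.
    obtain ⟨δ, hδ0, hδ⟩ := exists_between hε
    have hx : ∀ x, ∃ i z, edist (f x) (toContraction (c.ι.app i) z) < δ := by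
      intro x
      obtain ⟨_, ⟨i, z, rfl⟩, h⟩ := EMetric.mem_closure_iff.1 (hd (f x)) δ hδ0
      exact ⟨i, z, h⟩
    choose i z hz using hx
    obtain ⟨k, hk⟩ := Finite.exists_le i
    let g : Contraction X.obj (F.obj k).obj :=
      ⟨fun x => toContraction (F.map (homOfLE (hk x))) (z x), hX.lipschitz _⟩
    refine ⟨(toContraction (c.ι.app k)).comp g, ⟨k, g, rfl⟩, ?_⟩
    change pathEDist f ((toContraction (c.ι.app k)).comp g) < ε
    rw [hX.pathEDist_contraction c.pt.property]
    refine (iSup_le fun x => ?_).trans_lt hδ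
    change edist (f x) (toContraction (c.ι.app k)
      (toContraction (F.map (homOfLE (hk x))) (z x))) ≤ δ
    rw [cocone_w_apply]
    exact (hz x).le

section Subsets

variable {C : CCMet.{u}} {I : Type u} [PartialOrder I] (B : I → Set C.obj)

/-- The diagram of an increasing family of closed convex subspaces. -/
def subsetDiagram (hm : Monotone B) (hcl : ∀ i, IsClosed (B i))
    (hcv : ∀ i, IsConvexMetric (B i)) : I ⥤ CCMet.{u} where
  obj i := ⟨@CMet.mk (B i) _ (hcl i).completeSpace_coe, hcv i⟩
  map f := ofContraction ⟨Set.inclusion (hm (leOfHom f)), fun x y => by simp; rfl⟩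
  map_id _ := rfl
  map_comp _ _ := rfl

/-- The cocone of the inclusions of the subspaces. -/
def subsetCocone (hm : Monotone B) (hcl : ∀ i, IsClosed (B i))
    (hcv : ∀ i, IsConvexMetric (B i)) : Cocone (subsetDiagram B hm hcl hcv) where
  pt := C
  ι := { app := fun i => ofContraction ⟨fun x : B i => (x : C.obj), LipschitzWith.subtype_val _⟩
         naturality := fun _ _ _ => rfl }

variable {B}

/-- A map out of an isometry-`ℵ₀`-generated object is approximated, in the intrinsic metric, by maps
into the stages of an increasing family of subspaces with dense union. -/
theorem IsIsometryGenerated.exists_pathEDist_lt {X : CCMet.{u}} (hX : X.IsIsometryGenerated ℵ₀)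
    [Nonempty I] [IsDirectedOrder I] (hm : Monotone B) (hcl : ∀ i, IsClosed (B i))
    (hcv : ∀ i, IsConvexMetric (B i)) (hd : Dense (⋃ i, B i)) (f : Contraction X.obj C.obj)
    {ε : ℝ≥0∞} (hε : 0 < ε) :
    ∃ i, ∃ g : Contraction X.obj C.obj, (∀ x, g x ∈ B i) ∧ pathEDist f g < ε := by
  let c := subsetCocone B hm hcl hcv
  have hd' : Dense (coconeRange c) := by
    refine hd.mono fun x hx => ?_
    obtain ⟨i, hi⟩ := Set.mem_iUnion.1 hx
    exact ⟨i, ⟨x, hi⟩, rfl⟩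
  obtain ⟨hc⟩ := nonempty_isColimit c (fun i => isometry_subtype_coe) hd'
  have := hX I (isKappaDirected_aleph0 I) (subsetDiagram B hm hcl hcv)
    (fun i j h x y => rfl)
  obtain ⟨hc'⟩ := this.preserves hc
  -- The preserved colimit lives in `CPMet`, so density holds for the path metric of the mapping
  -- space, which is stronger than density in the supremum metric.
  have hdense := dense_coconeRange (P := CMet.isPath.{u}) isPathMetric_real hc'
  obtain ⟨_, ⟨i, g, rfl⟩, h⟩ := EMetric.mem_closure_iff.1 (hdense f) ε hε
  change Contraction X.obj ((subsetDiagram B hm hcl hcv).obj i).obj at g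
  exact ⟨i, (toContraction (c.ι.app i)).comp g, fun x => (g x).2, h⟩

end Subsets

/-- The space is the directed union of its finite subsets. A self-map with values in one of them and
at finite distance from the identity must be the identity, as distinct points are at distance `∞`.
-/
theorem IsIsometryGenerated.finite {X : CCMet.{u}} (hX : X.IsIsometryGenerated ℵ₀)
    (hd : IsDiscreteMetric X.obj) : Finite X.obj := by
  classical
  obtain ⟨s, g, hg, hlt⟩ := hX.exists_pathEDist_lt (C := X) (I := Finset X.obj)
    (B := fun s => (s : Set X.obj)) (fun s t h => Finset.coe_subset.2 h)
    (fun s => s.finite_toSet.isClosed)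
    (fun s => IsDiscreteMetric.isConvexMetric fun x y h => hd x y (Subtype.coe_ne_coe.2 h))
    (by
      convert dense_univ
      exact Set.eq_univ_of_forall fun x => Set.mem_iUnion.2 ⟨{x}, by simp⟩)
    (Contraction.id X.obj) (ε := 1) one_pos
  have : ∀ x, x ∈ s := by
    intro x
    have h1 : edist x (g x) < 1 := ((Contraction.edist_apply_le (Contraction.id X.obj) g x).trans
      (edist_le_pathEDist _ _)).trans_lt hlt
    by_cases h : x = g x
    · rw [h]; exact hg x
    · rw [hd _ _ h] at h1
      exact absurd h1 (not_lt_of_ge le_top)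
  exact (Set.finite_univ_iff).1 (s.finite_toSet.subset fun x _ => this x)

end CCMet

/-! ## Two copies of the real line glued along a closed subset -/

/-- The inclusion of a set of real numbers in the line. -/
def lineInclusion (A : Set ℝ) (a : A) : ULift.{u} ℝ := ⟨a⟩

theorem isometry_lineInclusion (A : Set ℝ) : Isometry (lineInclusion.{u} A) := fun _ _ => rfl

/-- Two copies of the real line glued along `A`. -/
abbrev DoubleLine (A : Set ℝ) [Nonempty A] : Type u :=
  Metric.GlueSpace (isometry_lineInclusion.{u} A) (isometry_lineInclusion.{u} A)

namespace DoubleLine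

variable (A : Set ℝ) [Nonempty A]

/-- The left copy of the line. -/
noncomputable def left (x : ℝ) : DoubleLine.{u} A := Metric.toGlueL _ _ ⟨x⟩

/-- The right copy of the line. -/
noncomputable def right (x : ℝ) : DoubleLine.{u} A := Metric.toGlueR _ _ ⟨x⟩

theorem isometry_left : Isometry (left.{u} A) := fun x y =>
  (Metric.toGlueL_isometry _ _).edist_eq (ULift.up x) (ULift.up y)

theorem isometry_right : Isometry (right.{u} A) := fun x y =>
  (Metric.toGlueR_isometry _ _).edist_eq (ULift.up x) (ULift.up y)

variable {A}

theorem left_eq_right {a : ℝ} (ha : a ∈ A) : left.{u} A a = right A a :=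
  congrFun (Metric.toGlue_commute (isometry_lineInclusion A) (isometry_lineInclusion A)) ⟨a, ha⟩

theorem dist_left_right (x y : ℝ) :
    dist (left.{u} A x) (right A y) = ⨅ a : A, (|x - a| + |y - a|) := by
  -- The summand `0` is the gap parameter of the general gluing construction.
  change (⨅ a : A, (dist x (a : ℝ) + dist y (a : ℝ))) + 0 = _
  simp only [add_zero, Real.dist_eq]

theorem exists_rep (z : DoubleLine.{u} A) : ∃ p : ℝ ⊕ ℝ, Sum.elim (left A) (right A) p = z := by
  induction z using Quotient.inductionOn' with
  | h p =>
    rcases p with x | x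
    · exact ⟨Sum.inl x.down, rfl⟩
    · exact ⟨Sum.inr x.down, rfl⟩

/-- Two non-expansive maps on the line that agree on `A` can be glued. -/
theorem exists_desc {W : Type v} [MetricSpace W] {f g : ℝ → W} (hf : LipschitzWith 1 f)
    (hg : LipschitzWith 1 g) (hfg : ∀ a ∈ A, f a = g a) :
    ∃ h : DoubleLine.{u} A → W, LipschitzWith 1 h ∧ (∀ x, h (left A x) = f x) ∧
      ∀ x, h (right A x) = g x := by
  have hf' : ∀ x y, dist (f x) (f y) ≤ |x - y| := fun x y => by
    simpa [Real.dist_eq] using hf.dist_le_mul x y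
  have hg' : ∀ x y, dist (g x) (g y) ≤ |x - y| := fun x y => by
    simpa [Real.dist_eq] using hg.dist_le_mul x y
  have hlr : ∀ x y, dist (f x) (g y) ≤ dist (left.{u} A x) (right A y) := by
    intro x y
    rw [dist_left_right]
    refine le_ciInf fun a => ?_
    refine (dist_triangle _ (f a) _).trans (add_le_add (hf' _ _) ?_)
    rw [hfg a a.2, dist_comm]
    exact hg' _ _
  have key : ∀ p q : ℝ ⊕ ℝ, dist (Sum.elim f g p) (Sum.elim f g q) ≤
      dist (Sum.elim (left.{u} A) (right A) p) (Sum.elim (left A) (right A) q) := by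
    rintro (x | x) (y | y)
    · simp only [Sum.elim_inl, (isometry_left A).dist_eq, Real.dist_eq]; exact hf' x y
    · exact hlr x y
    · rw [dist_comm, dist_comm (Sum.elim (left A) _ _)]; exact hlr y x
    · simp only [Sum.elim_inr, (isometry_right A).dist_eq, Real.dist_eq]; exact hg' x y
  choose r hr using exists_rep (A := A)
  -- Two representatives of one point are at distance `0`, so by `key` the value does not depend on
  -- the choice `r`.
  have hrep : ∀ p, Sum.elim f g (r (Sum.elim (left.{u} A) (right A) p)) = Sum.elim f g p := by
    intro p
    have h := key (r (Sum.elim (left.{u} A) (right A) p)) p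
    rw [hr, dist_self] at h
    exact dist_le_zero.1 h
  refine ⟨fun z => Sum.elim f g (r z), LipschitzWith.of_dist_le_mul fun z w => ?_,
    fun x => hrep (Sum.inl x), fun x => hrep (Sum.inr x)⟩
  have h := key (r z) (r w)
  rw [hr, hr] at h
  simpa using h

instance : CompleteSpace (DoubleLine.{u} A) := by
  rw [completeSpace_iff_isComplete_univ]
  have h : (Set.univ : Set (DoubleLine.{u} A)) = Set.range (left A) ∪ Set.range (right A) := by
    refine (Set.eq_univ_of_forall fun z => ?_).symm
    obtain ⟨x | x, rfl⟩ := exists_rep z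
    · exact Or.inl ⟨x, rfl⟩
    · exact Or.inr ⟨x, rfl⟩
  rw [h]
  exact (isometry_left A).isUniformInducing.isComplete_range.union
    (isometry_right A).isUniformInducing.isComplete_range

variable (A) in
/-- The right line together with the points of the left line over `B`. -/
def part (B : Set ℝ) : Set (DoubleLine.{u} A) := left A '' B ∪ Set.range (right A)

theorem isClosed_part {B : Set ℝ} (hB : IsClosed B) : IsClosed (part.{u} A B) :=
  ((isometry_left A).isClosedEmbedding.isClosedMap _ hB).union
    (isometry_right A).isClosedEmbedding.isClosed_range

/-- The infimum over crossing points is attained because `A` is closed and the cost of crossing at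
`a` tends to infinity with `|a|`. The minimiser serves as an intermediate point between the two
sheets. -/
theorem exists_dist_left_right (hA : IsClosed A) (x y : ℝ) : ∃ a ∈ A,
    dist (left.{u} A x) (right A y) = |x - a| + |a - y| := by
  obtain ⟨⟨a₀, ha₀⟩⟩ := ‹Nonempty A›
  have hc : Continuous fun a : ℝ => |x - a| + |y - a| := by fun_prop
  obtain ⟨a, ha, hmin⟩ := hc.continuousOn.exists_isMinOn' hA ha₀ (by
    refine Filter.Eventually.filter_mono inf_le_left ?_
    filter_upwards [(tendsto_dist_right_cocompact_atTop x).eventually_ge_atTop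
      (|x - a₀| + |y - a₀|)] with a h
    rw [Real.dist_eq, abs_sub_comm a x] at h
    linarith [abs_nonneg (y - a)])
  refine ⟨a, ha, ?_⟩
  rw [dist_left_right, abs_sub_comm a]
  refine le_antisymm (ciInf_le ⟨0, ?_⟩ (⟨a, ha⟩ : A)) (le_ciInf fun b => hmin b.2)
  rintro _ ⟨b, rfl⟩
  positivity

/-- A gap of `B` is harmless when both its ends are glued: the right line then supplies the points
in between. Points on different sheets are separated by an optimal crossing point, unless that is
one of the two, in which case both lie on one sheet. -/
theorem isConvexMetric_part (hA : IsClosed A) {B : Set ℝ} (hAB : A ⊆ B)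
    (hB : ∀ x ∈ B, ∀ y ∈ B, x < y → (x ∈ A ∧ y ∈ A) ∨ ∃ z ∈ B, x < z ∧ z < y) :
    IsConvexMetric (part.{u} A B) := by
  suffices h : ∀ p ∈ part.{u} A B, ∀ q ∈ part.{u} A B, p ≠ q →
      ∃ z ∈ part A B, z ≠ p ∧ z ≠ q ∧ dist p q = dist p z + dist z q by
    rintro ⟨p, hp⟩ ⟨q, hq⟩ hpq -
    obtain ⟨z, hz, h1, h2, h3⟩ := h p hp q hq fun e => hpq (Subtype.ext e)
    refine ⟨⟨z, hz⟩, fun e => h1 (congrArg Subtype.val e), fun e => h2 (congrArg Subtype.val e), ?_⟩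
    change edist p q = edist p z + edist z q
    simp only [edist_dist]
    rw [h3, ENNReal.ofReal_add dist_nonneg dist_nonneg]
  have symm : ∀ {p q : DoubleLine.{u} A},
      (∃ z ∈ part A B, z ≠ p ∧ z ≠ q ∧ dist p q = dist p z + dist z q) →
      ∃ z ∈ part A B, z ≠ q ∧ z ≠ p ∧ dist q p = dist q z + dist z p := by
    rintro p q ⟨z, hz, h1, h2, h3⟩
    exact ⟨z, hz, h2, h1, by rw [dist_comm q, h3, dist_comm q, dist_comm z p, add_comm]⟩
  have btw : ∀ {e : ℝ → DoubleLine.{u} A}, Isometry e → ∀ {x y z}, x < z → z < y →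
      e z ∈ part A B →
      ∃ z ∈ part A B, z ≠ e x ∧ z ≠ e y ∧ dist (e x) (e y) = dist (e x) z + dist z (e y) := by
    intro e he x y z hxz hzy hz
    refine ⟨e z, hz, he.injective.ne hxz.ne', he.injective.ne hzy.ne, ?_⟩
    simp only [he.dist_eq, Real.dist_eq]
    rw [abs_of_neg (by linarith), abs_of_neg (by linarith), abs_of_neg (by linarith)]
    ring
  have rr : ∀ x y, x < y → ∃ z ∈ part A B, z ≠ right.{u} A x ∧ z ≠ right A y ∧
      dist (right A x) (right A y) = dist (right A x) z + dist z (right A y) := fun x y h =>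
    btw (isometry_right A) (z := (x + y) / 2) (by linarith) (by linarith) (Or.inr ⟨_, rfl⟩)
  have ll : ∀ x ∈ B, ∀ y ∈ B, x < y → ∃ z ∈ part A B, z ≠ left.{u} A x ∧ z ≠ left A y ∧
      dist (left A x) (left A y) = dist (left A x) z + dist z (left A y) := by
    intro x hx y hy h
    rcases hB x hx y hy h with ⟨hxA, hyA⟩ | ⟨z, hz, h1, h2⟩
    · rw [left_eq_right hxA, left_eq_right hyA]
      exact rr x y h
    · exact btw (isometry_left A) h1 h2 (Or.inl ⟨z, hz, rfl⟩)
  have ll' : ∀ x ∈ B, ∀ y ∈ B, left.{u} A x ≠ left A y → ∃ z ∈ part A B, z ≠ left.{u} A x ∧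
      z ≠ left A y ∧ dist (left A x) (left A y) = dist (left A x) z + dist z (left A y) := by
    intro x hx y hy h
    rcases lt_trichotomy x y with h' | rfl | h'
    · exact ll x hx y hy h'
    · exact absurd rfl h
    · exact symm (ll y hy x hx h')
  have rr' : ∀ x y, right.{u} A x ≠ right A y → ∃ z ∈ part A B, z ≠ right.{u} A x ∧
      z ≠ right A y ∧ dist (right A x) (right A y) = dist (right A x) z + dist z (right A y) := by
    intro x y h
    rcases lt_trichotomy x y with h' | rfl | h'
    · exact rr x y h'
    · exact absurd rfl h
    · exact symm (rr y x h')
  have lr : ∀ x ∈ B, ∀ y, left.{u} A x ≠ right A y → ∃ z ∈ part A B, z ≠ left.{u} A x ∧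
      z ≠ right A y ∧ dist (left A x) (right A y) = dist (left A x) z + dist z (right A y) := by
    intro x hx y h
    obtain ⟨a, ha, hd⟩ := exists_dist_left_right.{u} hA x y
    -- If the crossing point is an endpoint, it is not an admissible intermediate point; the pair is
    -- then rewritten as a pair on a single line.
    by_cases hxa : right.{u} A a = left A x
    · rw [← hxa] at h ⊢
      exact rr' a y h
    by_cases hya : right.{u} A a = right A y
    · rw [← hya, ← left_eq_right ha] at h ⊢
      exact ll' x hx a (hAB ha) h
    refine ⟨right A a, Or.inr ⟨a, rfl⟩, hxa, hya, ?_⟩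
    rw [hd, (isometry_right A).dist_eq, ← left_eq_right ha, (isometry_left A).dist_eq,
      Real.dist_eq, Real.dist_eq]
  rintro _ (⟨x, hx, rfl⟩ | ⟨x, rfl⟩) _ (⟨y, hy, rfl⟩ | ⟨y, rfl⟩) hpq
  · exact ll' x hx y hy hpq
  · exact lr x hx y hpq
  · exact symm (lr y hy x hpq.symm)
  · exact rr' x y hpq

theorem part_univ : part.{u} A Set.univ = Set.univ := by
  refine Set.eq_univ_of_forall fun z => ?_
  obtain ⟨x | x, rfl⟩ := exists_rep z
  · exact Or.inl ⟨x, trivial, rfl⟩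
  · exact Or.inr ⟨x, rfl⟩

theorem isConvexMetric (hA : IsClosed A) : IsConvexMetric (DoubleLine.{u} A) := by
  have h := isConvexMetric_part.{u} hA (Set.subset_univ A) fun x _ y _ hxy =>
    Or.inr ⟨(x + y) / 2, trivial, by linarith, by linarith⟩
  intro p q hpq hd
  have hm : ∀ z, z ∈ part.{u} A Set.univ := fun z => by rw [part_univ]; trivial
  obtain ⟨z, h1, h2, h3⟩ := h ⟨p, hm p⟩ ⟨q, hm q⟩ (fun e => hpq (congrArg Subtype.val e)) hd
  exact ⟨z, fun e => h1 (Subtype.ext e), fun e => h2 (Subtype.ext e), h3⟩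

end DoubleLine

/-! ## The two halves of a circle are not homotopic -/

/-- The homotopy lifts to the line, starting at `0`. By uniqueness of lifts it is constant `0` on
the edge `t = 0`, equal to `c` on `s = 0`, constant `l` on `t = T` and equal to `-d` on `s = S`. At
the corner `(S, T)` this gives `l = -l`. -/
theorem AddCircle.false_of_homotopy {l : ℝ} (hl : 0 < l) {K : ℝ × ℝ → AddCircle (2 * l)}
    (hK : Continuous K) {S T : ℝ} {c d : ℝ → ℝ} (hc : Continuous c) (hd : Continuous d)
    (hc0 : c 0 = 0) (hcT : c T = l) (hd0 : d 0 = 0) (hdT : d T = l)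
    (h0 : ∀ s, K (s, 0) = 0) (hT : ∀ s, K (s, T) = (l : AddCircle (2 * l)))
    (hKc : ∀ t, K (0, t) = (c t : AddCircle (2 * l)))
    (hKd : ∀ t, K (S, t) = ((-d t : ℝ) : AddCircle (2 * l))) : False := by
  have cov : IsCoveringMap ((↑) : ℝ → AddCircle (2 * l)) := AddCircle.isCoveringMap_coe _
  obtain ⟨F, ⟨hF0, hF⟩, -⟩ := cov.existsUnique_continuousMap_lifts ⟨K, hK⟩ (0, 0) 0 (h0 0).symm
  have hF : ∀ p, ((F p : ℝ) : AddCircle (2 * l)) = K p := congrFun hF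
  have e1 : (fun s => F (s, 0)) = fun _ => 0 :=
    cov.eq_of_comp_eq (by fun_prop) (by fun_prop)
      (funext fun s => (hF _).trans (h0 s)) 0 hF0
  have e2 : (fun t => F (0, t)) = c :=
    cov.eq_of_comp_eq (by fun_prop) hc (funext fun t => (hF _).trans (hKc t)) 0 (hF0.trans hc0.symm)
  have e3 : (fun s => F (s, T)) = fun _ => l :=
    cov.eq_of_comp_eq (by fun_prop) (by fun_prop)
      (funext fun s => (hF _).trans (hT s)) 0 ((congrFun e2 T).trans hcT)
  have e4 : (fun t => F (S, t)) = fun t => -d t :=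
    cov.eq_of_comp_eq (by fun_prop) (by fun_prop) (funext fun t => (hF _).trans (hKd t)) 0
      ((congrFun e1 S).trans (by simp [hd0]))
  have h1 := congrFun e3 S
  have h2 := congrFun e4 T
  rw [h1, hdT] at h2
  linarith

/-! ## A necklace of circles converging to a point -/

namespace Necklace

/-- The sequence `1 / (n + 1)` of gluing points. -/
noncomputable def knot (n : ℕ) : ℝ := 1 / ((n : ℝ) + 1)

theorem knot_pos (n : ℕ) : 0 < knot n := Nat.one_div_pos_of_nat

theorem knot_antitone : Antitone knot := fun _ _ h => Nat.one_div_le_one_div h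

theorem knot_succ_lt (n : ℕ) : knot (n + 1) < knot n := Nat.one_div_lt_one_div n.lt_succ_self

theorem exists_knot_lt {ε : ℝ} (hε : 0 < ε) : ∃ n, knot n < ε := exists_nat_one_div_lt hε

/-- The set along which the two lines are glued. -/
def glueSet : Set ℝ := Set.Iic 0 ∪ insert 0 (Set.range knot)

theorem knot_mem (n : ℕ) : knot n ∈ glueSet := Or.inr (Set.mem_insert_of_mem _ ⟨n, rfl⟩)

instance : Nonempty glueSet := ⟨⟨_, knot_mem 0⟩⟩

theorem isClosed_glueSet : IsClosed glueSet :=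
  isClosed_Iic.union
    -- Together with their limit `0` the knots form a compact set.
    (tendsto_one_div_add_atTop_nhds_zero_nat (𝕜 := ℝ)).isCompact_insert_range.isClosed

/-- The part of the left line that belongs to the `n`-th stage. -/
def stageSet (n : ℕ) : Set ℝ := glueSet ∪ Set.Ici (knot n)

/-- The `n`-th stage: the right line together with the left halves of the first circles. -/
def stage (n : ℕ) : Set (DoubleLine.{u} glueSet) := DoubleLine.part glueSet (stageSet n)

theorem monotone_stage : Monotone stage.{u} := fun _ _ h =>
  Set.union_subset_union_left _ (Set.image_mono
    (Set.union_subset_union_right _ (Set.Ici_subset_Ici.2 (knot_antitone h))))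

theorem isClosed_stage (n : ℕ) : IsClosed (stage.{u} n) :=
  DoubleLine.isClosed_part (isClosed_glueSet.union isClosed_Ici)

theorem isConvexMetric_stage (n : ℕ) : IsConvexMetric (stage.{u} n) := by
  refine DoubleLine.isConvexMetric_part isClosed_glueSet Set.subset_union_left ?_
  intro x hx y hy hxy
  by_cases hxn : knot n ≤ x
  · exact Or.inr ⟨(x + y) / 2, Or.inr (by rw [Set.mem_Ici]; linarith), by linarith, by linarith⟩
  have hxA : x ∈ glueSet := hx.resolve_right hxn
  by_cases hyA : y ∈ glueSet
  · exact Or.inl ⟨hxA, hyA⟩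
  have hyn : knot n ≤ y := hy.resolve_left hyA
  -- Here `x` is a glued point below `knot n` and `y` an unglued one above it.
  refine Or.inr ⟨knot n, Or.inl (knot_mem n), not_le.1 hxn, lt_of_le_of_ne hyn ?_⟩
  rintro rfl
  exact hyA (knot_mem n)

theorem iUnion_stage : ⋃ n, stage.{u} n = Set.univ := by
  refine Set.eq_univ_of_forall fun z => Set.mem_iUnion.2 ?_
  obtain ⟨x | x, rfl⟩ := DoubleLine.exists_rep z
  · rcases le_or_gt x 0 with h | h
    · exact ⟨0, Or.inl ⟨x, Or.inl (Or.inl h), rfl⟩⟩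
    · obtain ⟨n, hn⟩ := exists_knot_lt h
      exact ⟨n, Or.inl ⟨x, Or.inr hn.le, rfl⟩⟩
  · exact ⟨0, Or.inr ⟨x, rfl⟩⟩

/-- The position of a real number along the `k`-th circle. -/
noncomputable def clamp (k : ℕ) (x : ℝ) : ℝ := max (knot (k + 1)) (min x (knot k)) - knot (k + 1)

theorem abs_clamp_sub_le (k : ℕ) (x y : ℝ) : |clamp k x - clamp k y| ≤ |x - y| := by
  rw [clamp, clamp, sub_sub_sub_cancel_right]
  refine (abs_max_sub_max_le_max _ _ _ _).trans ?_
  simp only [sub_self, abs_zero]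
  refine max_le (abs_nonneg _) ((abs_min_sub_min_le_max _ _ _ _).trans ?_)
  simp

theorem continuous_clamp (k : ℕ) : Continuous (clamp k) := by unfold clamp; fun_prop

theorem clamp_of_le {k : ℕ} {x : ℝ} (h : x ≤ knot (k + 1)) : clamp k x = 0 := by
  rw [clamp, max_eq_left ((min_le_left _ _).trans h), sub_self]

theorem clamp_of_ge {k : ℕ} {x : ℝ} (h : knot k ≤ x) : clamp k x = knot k - knot (k + 1) := by
  rw [clamp, min_eq_right h, max_eq_right (knot_succ_lt k).le]

/-- No glued point lies strictly between consecutive knots, and the remaining points of the stage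
lie beyond `knot n ≥ knot k`. So on the left line the stage meets the `k`-th circle only in its two
gluing points. -/
theorem clamp_of_mem_stageSet {n k : ℕ} (hnk : n ≤ k) {x : ℝ} (hx : x ∈ stageSet n) :
    clamp k x = 0 ∨ clamp k x = knot k - knot (k + 1) := by
  have h0 : x ≤ 0 → clamp k x = 0 := fun h => clamp_of_le (h.trans (knot_pos _).le)
  rcases hx with (h | rfl | ⟨j, rfl⟩) | h
  · exact Or.inl (h0 h)
  · exact Or.inl (h0 le_rfl)
  · rcases le_or_gt j k with h | h
    · exact Or.inr (clamp_of_ge (knot_antitone h))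
    · exact Or.inl (clamp_of_le (knot_antitone h))
  · exact Or.inr (clamp_of_ge ((knot_antitone hnk).trans h))

/-- These are the fixed points of negation on the circle, where its two halves `x` and `-x` meet. -/
theorem coe_eq_coe_neg {l x : ℝ} (h : x = 0 ∨ x = l) :
    (x : AddCircle (2 * l)) = ((-x : ℝ) : AddCircle (2 * l)) := by
  rcases h with rfl | rfl
  · simp
  · rw [← sub_eq_zero, ← AddCircle.coe_sub, sub_neg_eq_add, ← two_mul, AddCircle.coe_period]

/-- The projection of the necklace to the line. -/
theorem exists_proj : ∃ π : DoubleLine.{u} glueSet → ℝ, LipschitzWith 1 π ∧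
    (∀ x, π (DoubleLine.left _ x) = x) ∧ ∀ x, π (DoubleLine.right _ x) = x :=
  DoubleLine.exists_desc LipschitzWith.id LipschitzWith.id fun _ _ => rfl

/-- The retraction of the necklace to the `k`-th circle. -/
theorem exists_retraction (k : ℕ) :
    ∃ r : DoubleLine.{u} glueSet → AddCircle (2 * (knot k - knot (k + 1))), LipschitzWith 1 r ∧
      (∀ x, r (DoubleLine.left _ x) = (clamp k x : ℝ)) ∧
      ∀ x, r (DoubleLine.right _ x) = (-clamp k x : ℝ) := by
  refine DoubleLine.exists_desc (LipschitzWith.of_dist_le_mul fun x y => ?_)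
    (LipschitzWith.of_dist_le_mul fun x y => ?_)
    fun a ha => coe_eq_coe_neg (clamp_of_mem_stageSet (n := k) le_rfl (Or.inl ha))
  · rw [NNReal.coe_one, one_mul, dist_eq_norm, ← AddCircle.coe_sub, Real.dist_eq]
    exact QuotientAddGroup.norm_mk_le_norm.trans (abs_clamp_sub_le k x y)
  · rw [NNReal.coe_one, one_mul, dist_eq_norm, ← AddCircle.coe_sub, Real.dist_eq, neg_sub_neg,
      abs_sub_comm]
    exact QuotientAddGroup.norm_mk_le_norm.trans (abs_clamp_sub_le k y x)

/-- The necklace as a complete convex metric space. -/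
noncomputable def space : CCMet.{u} :=
  ⟨⟨DoubleLine.{u} glueSet⟩, DoubleLine.isConvexMetric isClosed_glueSet⟩

/-- The geodesic on the left side of the necklace is not joined by a short rectifiable homotopy to a
curve in a stage. -/
theorem not_lipConn {X : Type u} [EMetricSpace X] {D : ℝ} (hD : 0 < D)
    {γ : ℝ → X} (hγ : Continuous γ) {ρ : X → ℝ} (h0 : ρ (γ 0) = 0) (h1 : ρ (γ D) = D)
    {f g : Contraction X (DoubleLine.{u} glueSet)}
    (hf : ∀ x, f x = DoubleLine.left _ (ρ x - D / 2)) {n : ℕ} (hg : ∀ x, g x ∈ stage.{u} n) :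
    ¬ LipConn (D / 4) f g := by
  rintro ⟨G, hG, hG0, hG1⟩
  -- The `k`-th circle has its open left half outside the stage and lies within the positions up to
  -- `D / 4`, so that the curves considered pass all of it.
  obtain ⟨k, hnk, hkD⟩ : ∃ k, n ≤ k ∧ knot k ≤ D / 4 := by
    obtain ⟨m, hm⟩ := exists_knot_lt (show 0 < D / 4 by linarith)
    exact ⟨max n m, le_max_left _ _, (knot_antitone (le_max_right _ _)).trans hm.le⟩
  obtain ⟨π, hπ, hπl, hπr⟩ := exists_proj.{u}
  obtain ⟨r, hr, hrl, hrr⟩ := exists_retraction.{u} k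
  -- At the two ends of the circle the retraction does not see on which line the point lies.
  have hclamp : ∀ z, clamp k (π z) = 0 ∨ clamp k (π z) = knot k - knot (k + 1) →
      r z = (clamp k (π z) : ℝ) := by
    intro z hz
    obtain ⟨x | x, rfl⟩ := DoubleLine.exists_rep z
    · simp only [Sum.elim_inl, hrl, hπl]
    · simp only [Sum.elim_inr, hrr, hπr] at hz ⊢
      exact (coe_eq_coe_neg hz).symm
  -- All maps `G s` are within `D / 4` of `f`, and the projection to the line is non-expansive.
  have hnear : ∀ s x, |π (G s x) - (ρ x - D / 2)| ≤ D / 4 := by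
    intro s x
    have hGs : edist (G s) f ≤ ENNReal.ofReal (D / 4) := by
      have key : ∀ s, 0 ≤ s → s ≤ D / 4 → edist (G s) f ≤ ENNReal.ofReal (D / 4) := by
        intro s hs hs'
        rw [← hG0 0 le_rfl]
        refine (hG s 0).trans ?_
        rw [ENNReal.coe_one, one_mul, edist_dist, Real.dist_eq, sub_zero, abs_of_nonneg hs]
        exact ENNReal.ofReal_le_ofReal hs'
      rcases le_total s 0 with h | h
      · rw [hG0 s h, edist_self]; exact bot_le
      rcases le_total s (D / 4) with h' | h'
      · exact key s h h'
      · rw [hG1 s h', ← hG1 _ le_rfl]; exact key _ (by linarith) le_rfl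
    have h := (Contraction.edist_apply_le (G s) f x).trans hGs
    have h2 := hπ (G s x) (f x)
    rw [ENNReal.coe_one, one_mul] at h2
    replace h2 := h2.trans h
    rw [hf, hπl, edist_dist, Real.dist_eq] at h2
    exact (ENNReal.ofReal_le_ofReal_iff (by linarith)).1 h2
  have hcont : Continuous fun p : ℝ × ℝ => G p.1 (γ p.2) := by
    -- Evaluation is 2-Lipschitz in the map and the point jointly.
    have hev : Continuous fun q : Contraction X (DoubleLine.{u} glueSet) × X => q.1 q.2 := by
      refine LipschitzWith.continuous (K := 2) fun p q => ?_
      refine (edist_triangle _ (p.1 q.2) _).trans ?_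
      rw [ENNReal.coe_ofNat, two_mul, Prod.edist_eq]
      exact add_le_add ((Contraction.edist_map_le _ _ _).trans (le_max_right _ _))
        ((Contraction.edist_apply_le _ _ _).trans (le_max_left _ _))
    exact hev.comp ((hG.continuous.comp continuous_fst).prodMk (hγ.comp continuous_snd))
  have hl : 0 < knot k - knot (k + 1) := sub_pos.2 (knot_succ_lt k)
  -- The position stays at most `-D / 2 + D / 4 < 0`, before the circle.
  have hstart : ∀ s, clamp k (π (G s (γ 0))) = 0 := by
    intro s
    have h := (abs_le.1 (hnear s (γ 0))).2
    rw [h0] at h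
    exact clamp_of_le (by linarith [knot_pos (k + 1)])
  -- The position stays at least `D / 2 - D / 4 = D / 4 ≥ knot k`, beyond the circle.
  have hend : ∀ s, clamp k (π (G s (γ D))) = knot k - knot (k + 1) := by
    intro s
    have h := (abs_le.1 (hnear s (γ D))).1
    rw [h1] at h
    exact clamp_of_ge (by linarith)
  refine AddCircle.false_of_homotopy hl (hr.continuous.comp hcont) (S := D / 4) (T := D)
    (c := fun t => clamp k (π (G 0 (γ t)))) (d := fun t => clamp k (π (G (D / 4) (γ t))))
    ?_ ?_ (hstart _) (hend _) (hstart _) (hend _) ?_ ?_ ?_ ?_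
  · exact (continuous_clamp k).comp (hπ.continuous.comp ((G 0).lipschitz.continuous.comp hγ))
  · exact (continuous_clamp k).comp (hπ.continuous.comp ((G (D / 4)).lipschitz.continuous.comp hγ))
  · intro s
    refine (hclamp _ (Or.inl (hstart s))).trans ?_
    rw [hstart s, AddCircle.coe_zero]
  · intro s
    refine (hclamp _ (Or.inr (hend s))).trans ?_
    rw [hend s]
  · intro t
    simp only [Function.comp, hG0 0 le_rfl, hf, hrl, hπl]
  · intro t
    simp only [Function.comp, hG1 _ le_rfl]
    -- A left point of the stage sits at an end of the circle, where the sign is immaterial; hence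
    -- the final curve runs in the right half throughout.
    obtain ⟨x, hx, h⟩ | ⟨x, h⟩ := hg (γ t)
    · rw [← h, hrl, hπl]
      exact coe_eq_coe_neg (clamp_of_mem_stageSet hnk hx)
    · rw [← h, hrr, hπr]

end Necklace

/-! ### Generated spaces are discrete; conclusion -/

namespace CCMet

/-- Two points at finite distance give a real-valued map by truncating the distance from one of
them. Shifted by half that distance, it crosses `0`, where the circles of the necklace accumulate,
and the resulting map to the left line contradicts approximation by the stages. -/
theorem IsIsometryGenerated.isDiscreteMetric {X : CCMet.{u}} (hX : X.IsIsometryGenerated ℵ₀) :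
    IsDiscreteMetric X.obj := by
  intro x y hxy
  by_contra hfin
  have hD : 0 < (edist x y).toReal := ENNReal.toReal_pos (edist_pos.2 hxy).ne' hfin
  obtain ⟨γ, hγ, hγ0, hγ1⟩ := X.property.lipConn hfin
  let τ : Contraction X.obj (ULift.{u} ℝ) := Contraction.truncate (fun z => edist x z)
    (edist x y) hfin fun z w => by rw [edist_comm z w]; exact edist_triangle x w z
  let f : Contraction X.obj (DoubleLine.{u} Necklace.glueSet) :=
    ⟨fun z => DoubleLine.left _ ((τ z).down - (edist x y).toReal / 2), fun z w => by
      rw [(DoubleLine.isometry_left _).edist_eq, edist_sub_right]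
      exact τ.lipschitz z w⟩
  obtain ⟨⟨n⟩, g, hg, hlt⟩ := hX.exists_pathEDist_lt (C := Necklace.space) (I := ULift.{u} ℕ)
    (B := fun n => Necklace.stage n.down) (fun _ _ h => Necklace.monotone_stage h)
    (fun n => Necklace.isClosed_stage n.down) (fun n => Necklace.isConvexMetric_stage n.down)
    (by
      refine dense_univ.mono fun z _ => ?_
      have hz : z ∈ ⋃ n, Necklace.stage.{u} n := by rw [Necklace.iUnion_stage]; trivial
      obtain ⟨n, hn⟩ := Set.mem_iUnion.1 hz
      exact Set.mem_iUnion.2 ⟨⟨n⟩, hn⟩) f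
    (ε := ENNReal.ofReal ((edist x y).toReal / 4)) (ENNReal.ofReal_pos.2 (by linarith))
  refine Necklace.not_lipConn hD hγ.continuous (ρ := fun z => (τ z).down) ?_ ?_ (fun _ => rfl) hg
    (lipConn_of_pathEDist_lt hlt)
  · change (min (edist x (γ 0)) (edist x y)).toReal = 0
    rw [hγ0 0 le_rfl, edist_self, min_eq_left zero_le, ENNReal.toReal_zero]
  · change (min (edist x (γ (edist x y).toReal)) (edist x y)).toReal = (edist x y).toReal
    rw [hγ1 _ le_rfl, min_self]

end CCMet

theorem mainTheorem3 :
    (∀ X : CCMet.{u}, X.IsIsometryGenerated ℵ₀ ↔ Finite X.obj ∧ IsDiscreteMetric X.obj) ∧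
      ∀ ℓ : ℝ, 0 < ℓ → ¬ (CCMet.segment.{u} ℓ).IsIsometryGenerated ℵ₀ := by
  refine ⟨fun X => ⟨fun h => ⟨h.finite h.isDiscreteMetric, h.isDiscreteMetric⟩, fun h => ?_⟩,
    fun ℓ hℓ h => ?_⟩
  · have := h.1
    exact X.isIsometryGenerated_of_finite h.2
  · have h0 : (0 : ℝ) ∈ Set.Icc 0 ℓ := ⟨le_rfl, hℓ.le⟩
    have h1 : ℓ ∈ Set.Icc 0 ℓ := ⟨hℓ.le, le_rfl⟩
    have hne : (ULift.up ⟨0, h0⟩ : ULift.{u} (Set.Icc 0 ℓ)) ≠ ULift.up ⟨ℓ, h1⟩ := fun e =>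
      hℓ.ne (congrArg (fun z : ULift.{u} (Set.Icc (0 : ℝ) ℓ) => (z.down : ℝ)) e)
    exact edist_ne_top (0 : ℝ) ℓ (h.isDiscreteMetric _ _ hne)
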